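/- Let $X$ be a complex Banach space with an unconditional Schauder basis $(e_j)_{j\ge1}$, and let $K$ be its unconditional constant, i.e. the least number with $\|\sum a_je_j\|\le K\|\sum c_je_j\|$ for all finite sums with $|a_j|\le|c_j|$. View $X$ (through coordinates) and $X^*$ (through $f\mapsto(f(e_j))_j$) as spaces of complex sequences, and let $\mathcal F=\mathcal F(X,X^*)$ be the Calderón space of bounded continuous functions $F:\{0\le\operatorname{Re}z\le1\}\to X+X^*$, analytic in the interior, such that $t\mapsto F(it)\in X$ and $t\mapsto F(1+it)\in X^*$ are bounded and continuous, with $\|F\|_{\mathcal F}=\max(\sup_t\|F(it)\|_X,\sup_t\|F(1+it)\|_{X^*})$. Put $\|x\|_{1/2}=\inf\{\|F\|_{\mathcal F}:F(1/2)=x\}$, the norm of $(X,X^*)_{1/2}$, and let $Z(X)$ be the space of all pairs $(x,y)$ of complex sequences for which $$\|(x,y)\|_{Z(X)}=\inf\{\|F\|_{\mathcal F}:F(1/2)=x,\ F'(1/2)=y\}$$ is finite. Let $v_{2j-1}=(e_j,0)$, $v_{2j}=(0,e_j)$, and let $Z(X_n)=[v_j]_{j\le 2n}\subseteq Z(X)$.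 Write $\langle x,v\rangle=\sum_j x_jv_j$ for sequences one of which is supported on $\{1,\dots,n\}$. There are functions $\lambda(K)>0$ and $g(K,D)>0$, not depending on $X$ or its basis, such that the following holds for every such $X$. (a) For every $n\ge1$ the space $Z(X_n)$ is $\lambda(K)$-isomorphic to its dual; more precisely, the natural duality map $T:Z(X_n)\to Z(X_n)^*$, $$\langle T(x,y),(u,v)\rangle=\langle y,u\rangle-\langle x,v\rangle,$$ is an onto isomorphism with $\|T\|\,\|T^{-1}\|\le\lambda(K)$. In particular, for each $X$ there is one $\lambda$ that serves all $n$. (b) Let $\rho>1$, let $B$ be a homogeneous $\rho$-bounded selection for the evaluation $F\mapsto F(1/2)$ of $\mathcal F$ onto $(X,X^*)_{1/2}$ (so $B(x)(1/2)=x$, $\|B(x)\|_{\mathcal F}\le\rho\|x\|_{1/2}$ and $B(cx)=cB(x)$), and let $\Omega(x)=B(x)'(1/2)$. Let $\Delta(\Omega)$ be the least $C\in[0,\infty]$ with $\|\Omega(ax)-a\Omega(x)\|_{1/2}\le C\|a\|_\infty\|x\|_{1/2}$ for all $a\in\ell_\infty$, $x\in(X,X^*)_{1/2}$. Then $\Delta(\Omega)\le4K\rho$.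 For every $n\ge1$ let $d_{\pm\Omega^n}$ be the space of pairs of sequences supported on $\{1,\dots,n\}$ with the quasi-norm $\|(x,y)\|_{\pm\Omega}=\|x\mp\Omega(y)\|_{1/2}+\|y\|_{1/2}$. Then the duality map $$I:d_{\Omega^n}\to(d_{-\Omega^n})^*,\qquad \langle I(x,y),(u,v)\rangle=\langle x,v\rangle+\langle y,u\rangle,$$ is a bijection, and with $g=g(K,\Delta(\Omega))$ $$\|I(x,y)\|\le g\,\|(x,y)\|_{\Omega},\qquad \|(x,y)\|_{\Omega}\le g\,\|I(x,y)\|,$$ where $\|\varphi\|=\sup\{|\varphi(q)|:\|q\|_{-\Omega}\le1\}$. -/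

import Mathlib

open scoped ENNReal BoundedContinuousFunction

namespace DerivedTwisted

noncomputable section

variable {X : Type*} [NormedAddCommGroup X] [NormedSpace ℂ X]

/-- The unconditional constant of a basis `b`: the least `K` such that
`‖∑ aⱼ bⱼ‖ ≤ K ‖∑ cⱼ bⱼ‖` for all finite sums with `|aⱼ| ≤ |cⱼ|`. -/
def unconditionalConst (b : UnconditionalSchauderBasis ℕ ℂ X) : ℝ :=
  sInf {K : ℝ | ∀ (N : ℕ) (a c : ℕ → ℂ), (∀ j, ‖a j‖ ≤ ‖c j‖) →
    ‖∑ j ∈ Finset.range N, a j • b j‖ ≤ K * ‖∑ j ∈ Finset.range N, c j • b j‖}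

/-! ### The compatible couple `(X, X*)`

Both `X` and `X*` are regarded as spaces of complex sequences, a vector `x` through its
coordinates and a functional `f` through the values `f (eⱼ)`. -/

/-- The map `(x, f) ↦ x + f` from `X × X*` to the space of all complex sequences. -/
def sumCoord (b : UnconditionalSchauderBasis ℕ ℂ X) : (X × StrongDual ℂ X) →L[ℂ] (ℕ → ℂ) :=
  ContinuousLinearMap.pi fun j =>
    (b.coord j).comp (ContinuousLinearMap.fst ℂ X (StrongDual ℂ X)) +
      (ContinuousLinearMap.apply ℂ ℂ (b j)).comp (ContinuousLinearMap.snd ℂ X (StrongDual ℂ X))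

theorem sumCoord_apply (b : UnconditionalSchauderBasis ℕ ℂ X) (p : X × StrongDual ℂ X) (j : ℕ) :
    sumCoord b p j = b.coord j p.1 + p.2 (b j) := by
  simp [sumCoord]

/-- The pairs `(x, f)` with `x + f = 0` as sequences. -/
def sumKer (b : UnconditionalSchauderBasis ℕ ℂ X) : Submodule ℂ (X × StrongDual ℂ X) :=
  (sumCoord b).toLinearMap.ker

instance isClosed_sumKer (b : UnconditionalSchauderBasis ℕ ℂ X) :
    IsClosed (sumKer b : Set (X × StrongDual ℂ X)) :=
  (sumCoord b).isClosed_ker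

/-- The sum space `X + X*`, with the norm `inf {max ‖x‖ ‖f‖ : w = x + f}`, which is equivalent to
the usual `inf {‖x‖ + ‖f‖ : w = x + f}`; only its topology and bounded sets are used below. -/
def SumSpace (b : UnconditionalSchauderBasis ℕ ℂ X) : Type _ :=
  (X × StrongDual ℂ X) ⧸ sumKer b

instance (b : UnconditionalSchauderBasis ℕ ℂ X) : NormedAddCommGroup (SumSpace b) :=
  inferInstanceAs (NormedAddCommGroup ((X × StrongDual ℂ X) ⧸ sumKer b))

instance (b : UnconditionalSchauderBasis ℕ ℂ X) : NormedSpace ℂ (SumSpace b) :=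
  inferInstanceAs (NormedSpace ℂ ((X × StrongDual ℂ X) ⧸ sumKer b))

/-- The quotient map `(x, f) ↦ x + f` onto `X + X*`. -/
def toSum (b : UnconditionalSchauderBasis ℕ ℂ X) : (X × StrongDual ℂ X) →ₗ[ℂ] SumSpace b :=
  (sumKer b).mkQ

/-- The inclusion of `X` in `X + X*`. -/
def inclX (b : UnconditionalSchauderBasis ℕ ℂ X) : X →ₗ[ℂ] SumSpace b :=
  (toSum b).comp (LinearMap.inl ℂ X (StrongDual ℂ X))

/-- The inclusion of `X*` in `X + X*`. -/
def inclDual (b : UnconditionalSchauderBasis ℕ ℂ X) : StrongDual ℂ X →ₗ[ℂ] SumSpace b :=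
  (toSum b).comp (LinearMap.inr ℂ X (StrongDual ℂ X))

/-- The inclusion of `X + X*` in the space of all complex sequences. -/
def toSeq (b : UnconditionalSchauderBasis ℕ ℂ X) : SumSpace b →ₗ[ℂ] (ℕ → ℂ) :=
  (sumKer b).liftQ (sumCoord b).toLinearMap le_rfl

/-! ### The Calderón space -/

/-- The open strip `0 < re z < 1`. -/
def strip : Set ℂ := Complex.re ⁻¹' Set.Ioo 0 1

/-- The closed strip `0 ≤ re z ≤ 1`. -/
def closedStrip : Set ℂ := Complex.re ⁻¹' Set.Icc 0 1

/-- The Calderón space `𝓕(X, X*)`: bounded continuous functions `F` from the closed strip to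
`X + X*`, analytic in the open strip, such that `t ↦ F (i t)` is a bounded continuous function
into `X` and `t ↦ F (1 + i t)` is a bounded continuous function into `X*`.
An element is recorded as a triple `(F, F₀, F₁)`, where `F₀` and `F₁` are the two boundary
functions (they are determined by `F`; the values of `F` off the closed strip are irrelevant). -/
def calderon (b : UnconditionalSchauderBasis ℕ ℂ X) :
    Submodule ℂ ((ℂ → SumSpace b) × (ℝ →ᵇ X) × (ℝ →ᵇ StrongDual ℂ X)) where
  carrier := {F | DiffContOnCl ℂ F.1 strip ∧ (∃ C : ℝ, ∀ z ∈ closedStrip, ‖F.1 z‖ ≤ C) ∧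
    (∀ t : ℝ, F.1 (t * Complex.I) = inclX b (F.2.1 t)) ∧
    (∀ t : ℝ, F.1 (1 + t * Complex.I) = inclDual b (F.2.2 t))}
  add_mem' := by
    rintro F G ⟨hF, ⟨C, hC⟩, hF0, hF1⟩ ⟨hG, ⟨D, hD⟩, hG0, hG1⟩
    refine ⟨hF.add hG, ⟨C + D, fun z hz => ?_⟩, fun t => ?_, fun t => ?_⟩
    · exact (norm_add_le (F.1 z) (G.1 z)).trans (add_le_add (hC z hz) (hD z hz))
    · simp only [Prod.fst_add, Prod.snd_add, Pi.add_apply, hF0, hG0,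
        BoundedContinuousFunction.coe_add, map_add]
    · simp only [Prod.fst_add, Prod.snd_add, Pi.add_apply, hF1, hG1,
        BoundedContinuousFunction.coe_add, map_add]
  zero_mem' := by
    refine ⟨diffContOnCl_const, ⟨0, fun z _ => ?_⟩, fun t => ?_, fun t => ?_⟩
    · exact (norm_zero (E := SumSpace b)).le
    · exact (map_zero (inclX b)).symm
    · exact (map_zero (inclDual b)).symm
  smul_mem' := by
    rintro c F ⟨hF, ⟨C, hC⟩, hF0, hF1⟩
    refine ⟨hF.const_smul c, ⟨‖c‖ * C, fun z hz => ?_⟩, fun t => ?_, fun t => ?_⟩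
    · exact (norm_smul_le c (F.1 z)).trans (mul_le_mul_of_nonneg_left (hC z hz) (norm_nonneg c))
    · simp only [Prod.smul_fst, Prod.smul_snd, Pi.smul_apply, hF0,
        BoundedContinuousFunction.coe_smul, map_smul]
    · simp only [Prod.smul_fst, Prod.smul_snd, Pi.smul_apply, hF1,
        BoundedContinuousFunction.coe_smul, map_smul]

/-- The norm of the Calderón space, `max (sup_t ‖F (i t)‖_X) (sup_t ‖F (1 + i t)‖_{X*})`. -/
def calderonNorm {b : UnconditionalSchauderBasis ℕ ℂ X} (F : calderon b) : ℝ :=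
  max ‖F.1.2.1‖ ‖F.1.2.2‖

theorem isOpen_strip : IsOpen strip :=
  isOpen_Ioo.preimage Complex.continuous_re

theorem half_mem_strip : (1 / 2 : ℂ) ∈ strip := by
  constructor <;> norm_num

theorem differentiableAt_half {b : UnconditionalSchauderBasis ℕ ℂ X} (F : calderon b) :
    DifferentiableAt ℂ F.1.1 (1 / 2) :=
  F.2.1.differentiableAt isOpen_strip half_mem_strip

/-- Evaluation `F ↦ F (1/2)`. -/
def evalHalf (b : UnconditionalSchauderBasis ℕ ℂ X) : calderon b →ₗ[ℂ] (ℕ → ℂ) where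
  toFun F := toSeq b (F.1.1 (1 / 2))
  map_add' F G := by simp
  map_smul' c F := by simp

/-- Evaluation of the derivative, `F ↦ F' (1/2)`. -/
def derivHalf (b : UnconditionalSchauderBasis ℕ ℂ X) : calderon b →ₗ[ℂ] (ℕ → ℂ) where
  toFun F := toSeq b (deriv F.1.1 (1 / 2))
  map_add' F G := by
    rw [← map_add]
    congr 1
    exact deriv_add (differentiableAt_half F) (differentiableAt_half G)
  map_smul' c F := by
    rw [RingHom.id_apply, ← map_smul]
    congr 1
    exact deriv_const_smul c (differentiableAt_half F)

/-- The norm of the interpolation space `(X, X*)_{1/2}`, with value `∞` on the sequences that do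
not belong to that space. -/
def interpENorm (b : UnconditionalSchauderBasis ℕ ℂ X) (x : ℕ → ℂ) : ℝ≥0∞ :=
  ⨅ (F : calderon b) (_ : evalHalf b F = x), ENNReal.ofReal (calderonNorm F)

/-! ### The derived space `Z(X)` -/

/-- The quantity `inf {‖F‖ : F (1/2) = x, F' (1/2) = y}`, which is `∞` if there is no such `F`. -/
def derivedENorm (b : UnconditionalSchauderBasis ℕ ℂ X) (p : (ℕ → ℂ) × (ℕ → ℂ)) : ℝ≥0∞ :=
  ⨅ (F : calderon b) (_ : evalHalf b F = p.1 ∧ derivHalf b F = p.2),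
    ENNReal.ofReal (calderonNorm F)

theorem derivedENorm_lt_iff (b : UnconditionalSchauderBasis ℕ ℂ X) (p : (ℕ → ℂ) × (ℕ → ℂ))
    (c : ℝ≥0∞) : derivedENorm b p < c ↔ ∃ F : calderon b, (evalHalf b F = p.1 ∧
      derivHalf b F = p.2) ∧ ENNReal.ofReal (calderonNorm F) < c := by
  simp only [derivedENorm, iInf_lt_iff, exists_prop]

theorem calderonNorm_nonneg {b : UnconditionalSchauderBasis ℕ ℂ X} (F : calderon b) :
    0 ≤ calderonNorm F := le_max_of_le_left (norm_nonneg _)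

theorem calderonNorm_add_le {b : UnconditionalSchauderBasis ℕ ℂ X} (F G : calderon b) :
    calderonNorm (F + G) ≤ calderonNorm F + calderonNorm G := by
  refine max_le ?_ ?_
  · exact (norm_add_le F.1.2.1 G.1.2.1).trans (add_le_add (le_max_left _ _) (le_max_left _ _))
  · exact (norm_add_le F.1.2.2 G.1.2.2).trans (add_le_add (le_max_right _ _) (le_max_right _ _))

theorem calderonNorm_smul_le {b : UnconditionalSchauderBasis ℕ ℂ X} (c : ℂ) (F : calderon b) :
    calderonNorm (c • F) ≤ ‖c‖ * calderonNorm F := by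
  refine max_le ?_ ?_
  · refine (BoundedContinuousFunction.norm_le
      (mul_nonneg (norm_nonneg c) (calderonNorm_nonneg F))).2 fun t => ?_
    refine (norm_smul_le c (F.1.2.1 t)).trans (mul_le_mul_of_nonneg_left ?_ (norm_nonneg c))
    exact (BoundedContinuousFunction.norm_coe_le_norm _ _).trans (le_max_left _ _)
  · refine (BoundedContinuousFunction.norm_le
      (mul_nonneg (norm_nonneg c) (calderonNorm_nonneg F))).2 fun t => ?_
    refine (norm_smul_le c (F.1.2.2 t)).trans (mul_le_mul_of_nonneg_left ?_ (norm_nonneg c))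
    exact (BoundedContinuousFunction.norm_coe_le_norm _ _).trans (le_max_right _ _)

theorem derivedENorm_le (b : UnconditionalSchauderBasis ℕ ℂ X) (F : calderon b) :
    derivedENorm b (evalHalf b F, derivHalf b F) ≤ ENNReal.ofReal (calderonNorm F) :=
  iInf₂_le F ⟨rfl, rfl⟩

theorem derivedENorm_add_le (b : UnconditionalSchauderBasis ℕ ℂ X) (p q : (ℕ → ℂ) × (ℕ → ℂ)) :
    derivedENorm b (p + q) ≤ derivedENorm b p + derivedENorm b q := by
  refine ENNReal.le_of_forall_pos_le_add fun ε hε htop => ?_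
  have hp : derivedENorm b p ≠ ∞ := (lt_of_le_of_lt le_self_add htop).ne
  have hq : derivedENorm b q ≠ ∞ := (lt_of_le_of_lt le_add_self htop).ne
  have hε2 : ((ε / 2 : NNReal) : ℝ≥0∞) ≠ 0 := by
    simpa using hε.ne'
  obtain ⟨F, ⟨hF1, hF2⟩, hF⟩ := (derivedENorm_lt_iff b p _).1 (ENNReal.lt_add_right hp hε2)
  obtain ⟨G, ⟨hG1, hG2⟩, hG⟩ := (derivedENorm_lt_iff b q _).1 (ENNReal.lt_add_right hq hε2)
  have h := derivedENorm_le b (F + G)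
  rw [map_add, map_add, hF1, hF2, hG1, hG2] at h
  refine h.trans ((ENNReal.ofReal_le_ofReal (calderonNorm_add_le F G)).trans ?_)
  rw [ENNReal.ofReal_add (calderonNorm_nonneg F) (calderonNorm_nonneg G)]
  refine (add_le_add hF.le hG.le).trans (le_of_eq ?_)
  rw [add_add_add_comm, ← ENNReal.coe_add, add_halves]

theorem derivedENorm_smul_le (b : UnconditionalSchauderBasis ℕ ℂ X) (c : ℂ)
    (p : (ℕ → ℂ) × (ℕ → ℂ)) (hp : derivedENorm b p < ∞) :
    derivedENorm b (c • p) ≤ ENNReal.ofReal ‖c‖ * derivedENorm b p := by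
  refine ENNReal.le_of_forall_pos_le_add fun ε hε _ => ?_
  have hδ : ((ε / (‖c‖₊ + 1) : NNReal) : ℝ≥0∞) ≠ 0 := by
    rw [Ne, ENNReal.coe_eq_zero]
    exact (div_pos hε (by positivity)).ne'
  obtain ⟨F, ⟨hF1, hF2⟩, hF⟩ := (derivedENorm_lt_iff b p _).1 (ENNReal.lt_add_right hp.ne hδ)
  have h := derivedENorm_le b (c • F)
  rw [map_smul, map_smul, hF1, hF2] at h
  refine h.trans ((ENNReal.ofReal_le_ofReal (calderonNorm_smul_le c F)).trans ?_)
  rw [ENNReal.ofReal_mul (norm_nonneg c)]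
  refine (mul_le_mul_right hF.le _).trans ?_
  rw [mul_add]
  refine add_le_add le_rfl ?_
  rw [ofReal_norm, enorm_eq_nnnorm, ← ENNReal.coe_mul, ENNReal.coe_le_coe]
  calc ‖c‖₊ * (ε / (‖c‖₊ + 1)) = ε * (‖c‖₊ / (‖c‖₊ + 1)) := by ring
    _ ≤ ε * 1 := by
        refine mul_le_mul_of_nonneg_left ?_ zero_le
        exact div_le_one_of_le₀ (le_add_of_nonneg_right zero_le_one) zero_le
    _ = ε := mul_one _

theorem derivedENorm_zero (b : UnconditionalSchauderBasis ℕ ℂ X) : derivedENorm b 0 = 0 := by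
  have h := derivedENorm_le b (0 : calderon b)
  rw [map_zero, map_zero] at h
  refine le_antisymm (h.trans (le_of_eq ?_)) zero_le
  have h0 : calderonNorm (0 : calderon b) = 0 := by
    change max ‖(0 : ℝ →ᵇ X)‖ ‖(0 : ℝ →ᵇ StrongDual ℂ X)‖ = 0
    rw [norm_zero, max_eq_left_iff]
    exact (norm_zero (E := ℝ →ᵇ StrongDual ℂ X)).le
  rw [h0, ENNReal.ofReal_zero]

/-- The set `Z(X) = {(x, y) : ‖(x, y)‖ < ∞}` as a linear subspace of the pairs of sequences. -/
def derivedSubmodule (b : UnconditionalSchauderBasis ℕ ℂ X) :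
    Submodule ℂ ((ℕ → ℂ) × (ℕ → ℂ)) where
  carrier := {p | derivedENorm b p < ∞}
  add_mem' hp hq := (derivedENorm_add_le b _ _).trans_lt (ENNReal.add_lt_top.2 ⟨hp, hq⟩)
  zero_mem' := by
    change derivedENorm b 0 < ∞
    simp [derivedENorm_zero]
  smul_mem' c p hp := (derivedENorm_smul_le b c p hp).trans_lt
    (ENNReal.mul_lt_top ENNReal.ofReal_lt_top hp)

/-- The derived space `Z(X)`. -/
def Z (b : UnconditionalSchauderBasis ℕ ℂ X) : Type := ↥(derivedSubmodule b)

/-- The additive group underlying `Z(X)`. -/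
@[reducible] def Z.preGroup (b : UnconditionalSchauderBasis ℕ ℂ X) : AddCommGroup (Z b) :=
  inferInstanceAs (AddCommGroup ↥(derivedSubmodule b))

section

attribute [local instance] Z.preGroup

/-- The vector space underlying `Z(X)`. -/
@[reducible] def Z.preModule (b : UnconditionalSchauderBasis ℕ ℂ X) : Module ℂ (Z b) :=
  inferInstanceAs (Module ℂ ↥(derivedSubmodule b))

end

/-- The two sequences `(x, y)` of an element of `Z(X)`. -/
def Z.pair {b : UnconditionalSchauderBasis ℕ ℂ X} (p : Z b) : (ℕ → ℂ) × (ℕ → ℂ) := p.1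

instance (b : UnconditionalSchauderBasis ℕ ℂ X) : Norm (Z b) :=
  ⟨fun p => (derivedENorm b p.pair).toReal⟩

/-- Maximum principle: `‖F z‖ ≤ ‖F‖` on the closed strip. -/
theorem norm_le_calderonNorm {b : UnconditionalSchauderBasis ℕ ℂ X} (F : calderon b) {z : ℂ}
    (hz : z ∈ closedStrip) : ‖F.1.1 z‖ ≤ calderonNorm F := by
  obtain ⟨hd, ⟨C, hC⟩, h0, h1⟩ := F.2
  refine PhragmenLindelof.vertical_strip (a := 0) (b := 1) hd ⟨0, by simp [Real.pi_pos], 0, ?_⟩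
    (fun w hw => ?_) (fun w hw => ?_) hz.1 hz.2
  · simp only [zero_mul, Real.exp_zero]
    refine Asymptotics.IsBigO.of_bound C ?_
    refine Filter.Eventually.filter_mono inf_le_right ?_
    refine Filter.eventually_principal.2 fun w hw => ?_
    simpa using hC w ⟨hw.1.le, hw.2.le⟩
  · have hw' : w = (w.im : ℂ) * Complex.I := by apply Complex.ext <;> simp [hw]
    rw [hw', h0]
    refine (Submodule.Quotient.norm_mk_le (sumKer b) _).trans ?_
    rw [LinearMap.inl_apply, Prod.norm_def, norm_zero, max_eq_left (norm_nonneg _)]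
    exact (BoundedContinuousFunction.norm_coe_le_norm _ _).trans (le_max_left _ _)
  · have hw' : w = 1 + (w.im : ℂ) * Complex.I := by apply Complex.ext <;> simp [hw]
    rw [hw', h1]
    refine (Submodule.Quotient.norm_mk_le (sumKer b) _).trans ?_
    rw [LinearMap.inr_apply, Prod.norm_def, norm_zero, max_eq_right (norm_nonneg _)]
    exact (BoundedContinuousFunction.norm_coe_le_norm _ _).trans (le_max_right _ _)

theorem norm_deriv_le_calderonNorm {b : UnconditionalSchauderBasis ℕ ℂ X} (F : calderon b) :
    ‖deriv F.1.1 (1 / 2)‖ ≤ calderonNorm F / (1 / 4) := by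
  have hsub : ∀ z ∈ Metric.closedBall (1 / 2 : ℂ) (1 / 4), z ∈ strip := by
    intro z hz
    have h := (Complex.abs_re_le_norm (z - 1 / 2)).trans (mem_closedBall_iff_norm.1 hz)
    have h2 : (z - 1 / 2).re = z.re - 1 / 2 := by simp
    rw [h2, abs_le] at h
    constructor <;> linarith [h.1, h.2]
  refine Complex.norm_deriv_le_of_forall_mem_sphere_norm_le (R := 1 / 4) (by norm_num) ?_ ?_
  · exact F.2.1.mono fun z hz => hsub z (Metric.ball_subset_closedBall hz)
  · intro z hz
    have h := hsub z (Metric.sphere_subset_closedBall hz)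
    exact norm_le_calderonNorm F ⟨h.1.le, h.2.le⟩

theorem eq_zero_of_derivedENorm_eq_zero (b : UnconditionalSchauderBasis ℕ ℂ X)
    (p : (ℕ → ℂ) × (ℕ → ℂ)) (hp : derivedENorm b p = 0) : p = 0 := by
  have key : ∀ ε : ℝ, 0 < ε → ∃ u v : SumSpace b, toSeq b u = p.1 ∧ toSeq b v = p.2 ∧
      ‖u‖ ≤ ε ∧ ‖v‖ ≤ ε := by
    intro ε hε
    have h : derivedENorm b p < ENNReal.ofReal (ε / 4) := by
      rw [hp]; simpa using hε
    obtain ⟨F, ⟨h1, h2⟩, hF⟩ := (derivedENorm_lt_iff b p _).1 h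
    have hF' : calderonNorm F < ε / 4 := (ENNReal.ofReal_lt_ofReal_iff (by positivity)).1 hF
    refine ⟨_, _, h1, h2, ?_, ?_⟩
    · refine (norm_le_calderonNorm F ⟨half_mem_strip.1.le, half_mem_strip.2.le⟩).trans ?_
      linarith
    · refine (norm_deriv_le_calderonNorm F).trans ?_
      linarith
  have hinj : Function.Injective (toSeq b) := by
    rw [← LinearMap.ker_eq_bot]
    exact Submodule.ker_liftQ_eq_bot _ _ _ le_rfl
  obtain ⟨u, v, hu, hv, -, -⟩ := key 1 one_pos
  have hu0 : u = 0 := by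
    refine norm_le_zero_iff.1 (le_of_forall_pos_le_add fun ε hε => ?_)
    obtain ⟨u', v', hu', -, hn, -⟩ := key ε hε
    rw [zero_add, hinj (hu.trans hu'.symm)]
    exact hn
  have hv0 : v = 0 := by
    refine norm_le_zero_iff.1 (le_of_forall_pos_le_add fun ε hε => ?_)
    obtain ⟨u', v', -, hv', -, hn⟩ := key ε hε
    rw [zero_add, hinj (hv.trans hv'.symm)]
    exact hn
  rw [hu0, map_zero] at hu
  rw [hv0, map_zero] at hv
  exact Prod.ext hu.symm hv.symm

section

attribute [local instance] Z.preGroup Z.preModule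

theorem Z.normCore (b : UnconditionalSchauderBasis ℕ ℂ X) : NormedSpace.Core ℂ (Z b) where
  norm_nonneg p := ENNReal.toReal_nonneg
  norm_smul c p := by
    have hle : ∀ (c : ℂ) (p : Z b), ‖c • p‖ ≤ ‖c‖ * ‖p‖ := by
      intro c p
      have h := ENNReal.toReal_mono (ENNReal.mul_lt_top ENNReal.ofReal_lt_top p.2).ne
        (derivedENorm_smul_le b c p.1 p.2)
      rw [ENNReal.toReal_mul, ENNReal.toReal_ofReal (norm_nonneg c)] at h
      exact h
    refine le_antisymm (hle c p) ?_
    rcases eq_or_ne c 0 with rfl | hc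
    · rw [norm_zero, zero_mul]
      exact ENNReal.toReal_nonneg
    · have h := hle c⁻¹ (c • p)
      rw [inv_smul_smul₀ hc, norm_inv] at h
      have hc' : 0 < ‖c‖ := norm_pos_iff.2 hc
      calc ‖c‖ * ‖p‖ ≤ ‖c‖ * (‖c‖⁻¹ * ‖c • p‖) := mul_le_mul_of_nonneg_left h hc'.le
        _ = ‖c • p‖ := by rw [← mul_assoc, mul_inv_cancel₀ hc'.ne', one_mul]
  norm_triangle p q := by
    have h := ENNReal.toReal_mono (ENNReal.add_lt_top.2 ⟨p.2, q.2⟩).ne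
      (derivedENorm_add_le b p.1 q.1)
    rw [ENNReal.toReal_add (ne_of_lt p.2) (ne_of_lt q.2)] at h
    exact h
  norm_eq_zero_iff p := by
    constructor
    · intro h
      rcases (ENNReal.toReal_eq_zero_iff _).1 h with h | h
      · exact Subtype.ext (eq_zero_of_derivedENorm_eq_zero b _ h)
      · exact absurd h (ne_of_lt p.2)
    · rintro rfl
      change (derivedENorm b 0).toReal = 0
      rw [derivedENorm_zero, ENNReal.toReal_zero]

instance (b : UnconditionalSchauderBasis ℕ ℂ X) : NormedAddCommGroup (Z b) :=
  NormedAddCommGroup.ofCore (Z.normCore b)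

instance (b : UnconditionalSchauderBasis ℕ ℂ X) : NormedSpace ℂ (Z b) :=
  NormedSpace.ofCore (Z.normCore b)

end

/-- The `j`-th unit vector sequence. -/
def unitSeq (j : ℕ) : ℕ → ℂ := Pi.single j 1

theorem toSeq_inclX_basis (b : UnconditionalSchauderBasis ℕ ℂ X) (j : ℕ) :
    toSeq b (inclX b (b j)) = unitSeq j := by
  ext i
  change sumCoord b (b j, 0) i = _
  rw [sumCoord_apply]
  simp [b.ortho, unitSeq, Pi.single_apply]

theorem inclX_basis_eq (b : UnconditionalSchauderBasis ℕ ℂ X) (j : ℕ) :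
    inclX b (b j) = inclDual b (b.coord j) := by
  refine (Submodule.Quotient.eq (sumKer b)).2 ?_
  refine LinearMap.mem_ker.2 (funext fun i => ?_)
  change sumCoord b ((b j, 0) - (0, b.coord j)) i = 0
  rw [sumCoord_apply]
  rcases eq_or_ne i j with rfl | hij
  · simp [b.ortho]
  · simp [b.ortho, hij, hij.symm]

/-- For a scalar function `α + β exp z`, the function `(α + β exp z) eⱼ`
of the Calderón space witnesses that `(F (1/2), F' (1/2))` belongs to `Z(X)`. -/
theorem exp_mem_derived (b : UnconditionalSchauderBasis ℕ ℂ X) (j : ℕ) (α β : ℂ) :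
    ((α + β * Complex.exp (1 / 2)) • unitSeq j, (β * Complex.exp (1 / 2)) • unitSeq j) ∈
      derivedSubmodule b := by
  set h : ℂ → ℂ := fun z => α + β * Complex.exp z with hh
  have hbd : ∀ z ∈ closedStrip, ‖h z‖ ≤ ‖α‖ + ‖β‖ * Real.exp 1 := by
    intro z hz
    refine (norm_add_le _ _).trans (add_le_add le_rfl ?_)
    rw [norm_mul, Complex.norm_exp]
    exact mul_le_mul_of_nonneg_left (Real.exp_le_exp.2 hz.2) (norm_nonneg β)
  have hdiff : Differentiable ℂ h := by fun_prop
  have hmem0 : ∀ t : ℝ, (t * Complex.I : ℂ) ∈ closedStrip := by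
    intro t; constructor <;> simp
  have hmem1 : ∀ t : ℝ, (1 + t * Complex.I : ℂ) ∈ closedStrip := by
    intro t; constructor <;> simp
  let f0 : ℝ →ᵇ X := BoundedContinuousFunction.ofNormedAddCommGroup
    (fun t : ℝ => h (t * Complex.I) • b j) (by fun_prop) ((‖α‖ + ‖β‖ * Real.exp 1) * ‖b j‖)
    (fun t => by
      rw [norm_smul]
      exact mul_le_mul_of_nonneg_right (hbd _ (hmem0 t)) (norm_nonneg _))
  let f1 : ℝ →ᵇ StrongDual ℂ X := BoundedContinuousFunction.ofNormedAddCommGroup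
    (fun t : ℝ => h (1 + t * Complex.I) • b.coord j) (by fun_prop)
    ((‖α‖ + ‖β‖ * Real.exp 1) * ‖b.coord j‖)
    (fun t => by
      rw [norm_smul]
      exact mul_le_mul_of_nonneg_right (hbd _ (hmem1 t)) (norm_nonneg _))
  have hF : ((fun z => h z • inclX b (b j), f0, f1) :
      (ℂ → SumSpace b) × (ℝ →ᵇ X) × (ℝ →ᵇ StrongDual ℂ X)) ∈ calderon b := by
    refine ⟨(hdiff.smul_const _).diffContOnCl,
      ⟨(‖α‖ + ‖β‖ * Real.exp 1) * ‖inclX b (b j)‖, fun z hz => ?_⟩, fun t => ?_, fun t => ?_⟩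
    · rw [norm_smul]
      exact mul_le_mul_of_nonneg_right (hbd z hz) (norm_nonneg _)
    · change h _ • inclX b (b j) = inclX b (h _ • b j)
      rw [map_smul]
    · change h _ • inclX b (b j) = inclDual b (h _ • b.coord j)
      rw [inclX_basis_eq]
      rw [map_smul]
  refine (derivedENorm_lt_iff b _ _).2 ⟨⟨_, hF⟩, ⟨?_, ?_⟩, ENNReal.ofReal_lt_top⟩
  · change toSeq b (h (1 / 2) • inclX b (b j)) = _
    rw [map_smul, toSeq_inclX_basis]
  · change toSeq b (deriv (fun z => h z • inclX b (b j)) (1 / 2)) = _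
    have hd : HasDerivAt h (β * Complex.exp (1 / 2)) (1 / 2) :=
      ((Complex.hasDerivAt_exp (1 / 2)).const_mul β).const_add α
    rw [(hd.smul_const _).deriv, map_smul, toSeq_inclX_basis]

theorem unitSeq_zero_mem (b : UnconditionalSchauderBasis ℕ ℂ X) (j : ℕ) :
    (unitSeq j, 0) ∈ derivedSubmodule b := by
  simpa using exp_mem_derived b j 1 0

theorem zero_unitSeq_mem (b : UnconditionalSchauderBasis ℕ ℂ X) (j : ℕ) :
    (0, unitSeq j) ∈ derivedSubmodule b := by
  have h := exp_mem_derived b j (-1) (Complex.exp (1 / 2))⁻¹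
  rw [inv_mul_cancel₀ (Complex.exp_ne_zero _)] at h
  simpa using h

/-- The natural basis of `Z(X)`, indexed from `0`: `v₂ⱼ = (eⱼ, 0)` and `v₂ⱼ₊₁ = (0, eⱼ)`. -/
def v (b : UnconditionalSchauderBasis ℕ ℂ X) (i : ℕ) : Z b :=
  if i % 2 = 0 then ⟨(unitSeq (i / 2), 0), unitSeq_zero_mem b (i / 2)⟩
  else ⟨(0, unitSeq (i / 2)), zero_unitSeq_mem b (i / 2)⟩

/-- The finite section `Z(Xₙ)`, the span in `Z(X)` of the first `2n` vectors of the natural basis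
(being finite-dimensional it is closed), with the norm of `Z(X)`. -/
def Zsection (b : UnconditionalSchauderBasis ℕ ℂ X) (n : ℕ) : Submodule ℂ (Z b) :=
  Submodule.span ℂ (v b '' Set.Iio (2 * n))

/-- `Z(Xₙ)` as a normed space. -/
def ZFin (b : UnconditionalSchauderBasis ℕ ℂ X) (n : ℕ) : Type := ↥(Zsection b n)

instance (b : UnconditionalSchauderBasis ℕ ℂ X) (n : ℕ) : NormedAddCommGroup (ZFin b n) :=
  inferInstanceAs (NormedAddCommGroup ↥(Zsection b n))

instance (b : UnconditionalSchauderBasis ℕ ℂ X) (n : ℕ) : NormedSpace ℂ (ZFin b n) :=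
  inferInstanceAs (NormedSpace ℂ ↥(Zsection b n))

/-- The first sequence `x` of an element `(x, y)` of `Z(Xₙ)`. -/
def ZFin.fst {b : UnconditionalSchauderBasis ℕ ℂ X} {n : ℕ} (p : ZFin b n) : ℕ → ℂ := p.1.pair.1

/-- The second sequence `y` of an element `(x, y)` of `Z(Xₙ)`. -/
def ZFin.snd {b : UnconditionalSchauderBasis ℕ ℂ X} {n : ℕ} (p : ZFin b n) : ℕ → ℂ := p.1.pair.2

/-! ### Centralizers and twisted sums -/

/-- `B` is a homogeneous `ρ`-bounded selection for the evaluation map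
`F ↦ F (1/2)` from `𝓕(X, X*)` onto `(X, X*)_{1/2}`; its values off that space are irrelevant. -/
structure IsBoundedSelection (b : UnconditionalSchauderBasis ℕ ℂ X) (ρ : ℝ)
    (B : (ℕ → ℂ) → calderon b) : Prop where
  eval_eq : ∀ x, interpENorm b x < ∞ → evalHalf b (B x) = x
  norm_le : ∀ x, interpENorm b x < ∞ →
    ENNReal.ofReal (calderonNorm (B x)) ≤ ENNReal.ofReal ρ * interpENorm b x
  homogeneous : ∀ (c : ℂ) (x : ℕ → ℂ), interpENorm b x < ∞ →
    ∀ z ∈ closedStrip, (B (c • x)).1.1 z = c • (B x).1.1 z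

/-- The map `Ω = δ' ∘ B` of a selection `B`, that is `Ω x = (B x)' (1/2)`. -/
def selectionMap {b : UnconditionalSchauderBasis ℕ ℂ X} (B : (ℕ → ℂ) → calderon b) :
    (ℕ → ℂ) → (ℕ → ℂ) := fun x => derivHalf b (B x)

/-- The centralizer constant `Δ(Ω)`: the least `C` such that
`‖Ω (a x) - a Ω x‖ ≤ C ‖a‖_∞ ‖x‖` for all `a ∈ ℓ_∞` and `x ∈ (X, X*)_{1/2}`. -/
def centralizerConst (b : UnconditionalSchauderBasis ℕ ℂ X) (Ω : (ℕ → ℂ) → (ℕ → ℂ)) : ℝ≥0∞ :=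
  sInf {C : ℝ≥0∞ | ∀ (a : lp (fun _ : ℕ => ℂ) ∞) (x : ℕ → ℂ), interpENorm b x < ∞ →
    interpENorm b (Ω (⇑a * x) - ⇑a * Ω x) ≤ C * ENNReal.ofReal ‖a‖ * interpENorm b x}

/-- The pairs of sequences supported on the first `n` coordinates. -/
def pairSection (n : ℕ) : Submodule ℂ ((ℕ → ℂ) × (ℕ → ℂ)) where
  carrier := {p | ∀ j, n ≤ j → p.1 j = 0 ∧ p.2 j = 0}
  add_mem' hp hq j hj := by simp [hp j hj, hq j hj]
  zero_mem' j _ := by simp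
  smul_mem' c p hp j hj := by simp [hp j hj]

/-- The quasi-norm `‖(x, y)‖ = ‖x - Ω y‖ + ‖y‖` of the twisted sum `d_Ω`. -/
def twistedENorm (b : UnconditionalSchauderBasis ℕ ℂ X) (Ω : (ℕ → ℂ) → (ℕ → ℂ))
    (p : (ℕ → ℂ) × (ℕ → ℂ)) : ℝ≥0∞ :=
  interpENorm b (p.1 - Ω p.2) + interpENorm b p.2

/-- The dual norm `sup {|φ q| : ‖q‖ ≤ 1}` on the linear functionals of the finite section
`d_{Ωⁿ}` (the pairs supported on the first `n` coordinates, with the quasi-norm of `d_Ω`). -/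
def twistedDualENorm (b : UnconditionalSchauderBasis ℕ ℂ X) (Ω : (ℕ → ℂ) → (ℕ → ℂ)) (n : ℕ)
    (φ : Module.Dual ℂ (pairSection n)) : ℝ≥0∞ :=
  ⨆ (q : pairSection n) (_ : twistedENorm b Ω q ≤ 1), ENNReal.ofReal ‖φ q‖

/-- The duality map `I (x, y) (u, v) = ⟨x, v⟩ + ⟨y, u⟩` on pairs supported on the first `n`
coordinates. -/
def dualityMap (n : ℕ) (p : pairSection n) : Module.Dual ℂ (pairSection n) where
  toFun q := ∑ j ∈ Finset.range n, (p.1.1 j * q.1.2 j + p.1.2 j * q.1.1 j)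
  map_add' q r := by
    rw [← Finset.sum_add_distrib]
    refine Finset.sum_congr rfl fun j _ => ?_
    simp only [Submodule.coe_add, Prod.fst_add, Prod.snd_add, Pi.add_apply]
    ring
  map_smul' c q := by
    rw [RingHom.id_apply, smul_eq_mul, Finset.mul_sum]
    refine Finset.sum_congr rfl fun j _ => ?_
    simp only [Submodule.coe_smul, Prod.smul_fst, Prod.smul_snd, Pi.smul_apply, smul_eq_mul]
    ring

end

end DerivedTwisted

open DerivedTwisted

universe u

/-! Write `K` for the unconditional constant. Everything rests on one analytic device. For `F`, `G`
in the Calderón space, the scalar function `z ↦ ⟨F z, G (1 - z)⟩` pairs `X` with `X*` on both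
boundary lines, so it is bounded by `K ‖F‖ ‖G‖` on the strip (`pairing_bounds`). Its value at `1/2`
is `⟨F(1/2), G(1/2)⟩`; its derivative there is `⟨F'(1/2), G(1/2)⟩ - ⟨F(1/2), G'(1/2)⟩`, which is the
duality of `Z(Xₙ)`.

The value at `1/2`, together with Lozanovskii's factorization (`exists_calderon_of_support`), shows
that on finitely supported sequences the norm of `(X, X*)_{1/2}` is the Euclidean norm up to powers
of `K`.

For (a), Cauchy's estimate for the derivative gives `‖T‖ ≤ 4K`. Conversely
(`norm_le_norm_derivedDuality`), testing `T(x, y)` on `(0, v)` controls `‖x‖₂`. Lift `x` to `F` and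
test on pairs `(G(1/2), G'(1/2))`: this controls `‖y - F'(1/2)‖₂`, and the remainder `(0, y -
F'(1/2))` is realized by a function vanishing at `1/2`. Equality of dimensions gives surjectivity.

For (b), `B(ax) - aB(x)` vanishes at `1/2`, so its derivative there is the value of its quotient by
`z - 1/2`; this yields `4Kρ`. From then on only the centralizer inequality and homogeneity are used,
so that `g` does not involve `ρ`. Two sequences `y`, `v` are bounded multiples of a common positive
`s`, and the terms in `Ω s` cancel in `⟨Ωy, v⟩ - ⟨y, Ωv⟩` (`norm_commutator_le`). Hence `⟨x, v⟩ +
⟨y, u⟩` equals `⟨x - Ωy, v⟩ + ⟨y, u + Ωv⟩` up to a controlled error, and both estimates follow by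
Euclidean duality. -/

namespace DerivedTwisted

open Filter
open scoped Topology

/-! ### The unconditional constant and diagonal operators on `X`. -/

section UnconditionalConstant

/-- The terms of each sign form a subset of `s`, so each sign contributes at most `M`. -/
theorem sum_abs_le_two_mul {s : Finset ℕ} {r : ℕ → ℝ} {M : ℝ}
    (h : ∀ t ⊆ s, |∑ j ∈ t, r j| ≤ M) : ∑ j ∈ s, |r j| ≤ 2 * M := by
  classical
  rw [← Finset.sum_filter_add_sum_filter_not s (fun j => 0 ≤ r j)]
  have h1 : ∑ j ∈ s with 0 ≤ r j, |r j| = ∑ j ∈ s with 0 ≤ r j, r j :=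
    Finset.sum_congr rfl fun j hj => abs_of_nonneg (Finset.mem_filter.1 hj).2
  have h2 : ∑ j ∈ s with ¬ 0 ≤ r j, |r j| = -∑ j ∈ s with ¬ 0 ≤ r j, r j := by
    rw [← Finset.sum_neg_distrib]
    exact Finset.sum_congr rfl fun j hj => abs_of_neg (not_le.1 (Finset.mem_filter.1 hj).2)
  rw [h1, h2]
  have h3 := abs_le.1 (h _ (Finset.filter_subset (fun j => 0 ≤ r j) s))
  have h4 := abs_le.1 (h _ (Finset.filter_subset (fun j => ¬ 0 ≤ r j) s))
  linarith [h3.2, h4.1]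

theorem sum_norm_le_four_mul {s : Finset ℕ} {z : ℕ → ℂ} {M : ℝ}
    (h : ∀ t ⊆ s, ‖∑ j ∈ t, z j‖ ≤ M) : ∑ j ∈ s, ‖z j‖ ≤ 4 * M := by
  have hre := sum_abs_le_two_mul (s := s) (r := fun j => (z j).re) (M := M) fun t ht => by
    rw [← Complex.re_sum]
    exact (Complex.abs_re_le_norm _).trans (h t ht)
  have him := sum_abs_le_two_mul (s := s) (r := fun j => (z j).im) (M := M) fun t ht => by
    rw [← Complex.im_sum]
    exact (Complex.abs_im_le_norm _).trans (h t ht)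
  calc ∑ j ∈ s, ‖z j‖ ≤ ∑ j ∈ s, (|(z j).re| + |(z j).im|) :=
        Finset.sum_le_sum fun j _ => Complex.norm_le_abs_re_add_abs_im _
    _ ≤ 4 * M := by rw [Finset.sum_add_distrib]; linarith

theorem basis_ne_zero {X : Type*} [NormedAddCommGroup X] [NormedSpace ℂ X]
    (b : UnconditionalSchauderBasis ℕ ℂ X) (j : ℕ) : b j ≠ 0 := by
  intro h
  have := b.ortho j j
  change b.coord j (b j) = _ at this
  rw [h] at this
  simp at this

/-- Take `a = c = 1` and a single basis vector. -/
theorem le_of_unconditional_bound {X : Type*} [NormedAddCommGroup X] [NormedSpace ℂ X]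
    (b : UnconditionalSchauderBasis ℕ ℂ X) {K : ℝ}
    (h : ∀ (N : ℕ) (a c : ℕ → ℂ), (∀ j, ‖a j‖ ≤ ‖c j‖) →
      ‖∑ j ∈ Finset.range N, a j • b j‖ ≤ K * ‖∑ j ∈ Finset.range N, c j • b j‖) : 1 ≤ K := by
  have h1 := h 1 1 1 (fun _ => le_rfl)
  have h2 : 0 < ‖b 0‖ := norm_pos_iff.2 (basis_ne_zero b 0)
  simp only [Finset.sum_range_one, Pi.one_apply, one_smul] at h1
  exact (le_mul_iff_one_le_left h2).1 h1

variable {X : Type*} [NormedAddCommGroup X] [NormedSpace ℂ X] [CompleteSpace X]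
  (b : UnconditionalSchauderBasis ℕ ℂ X)

/-- Without an admissible constant the infimum defining `unconditionalConst` would be the default
value `0`. Uniformly bounded coordinate projections bound all subset sums of `c j * f (b j)` for a
norming functional `f`, hence the sum of their moduli, which is monotone in the moduli of the
coefficients. -/
theorem exists_unconditional_bound : ∃ K : ℝ, ∀ (N : ℕ) (a c : ℕ → ℂ), (∀ j, ‖a j‖ ≤ ‖c j‖) →
    ‖∑ j ∈ Finset.range N, a j • b j‖ ≤ K * ‖∑ j ∈ Finset.range N, c j • b j‖ := by
  obtain ⟨C, hC⟩ := UnconditionalSchauderBasis.exists_norm_proj_le b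
  refine ⟨4 * C, fun N a c hac => ?_⟩
  set x := ∑ j ∈ Finset.range N, c j • b j with hx
  obtain ⟨f, hf1, hf⟩ := exists_dual_vector'' ℂ (∑ j ∈ Finset.range N, a j • b j)
  have hproj : ∀ t ⊆ Finset.range N, ‖∑ j ∈ t, c j * f (b j)‖ ≤ C * ‖x‖ := by
    intro t ht
    have h1 : b.proj t x = ∑ j ∈ t, c j • b j := by
      rw [GeneralSchauderBasis.proj_apply]
      refine Finset.sum_congr rfl fun j hj => ?_
      congr 1
      simp only [hx, map_sum, map_smul, b.ortho, smul_eq_mul]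
      rw [Finset.sum_eq_single j]
      · simp
      · intro i _ hij
        simp [hij.symm]
      · intro h
        exact absurd (ht hj) h
    have h2 : ∑ j ∈ t, c j * f (b j) = f (b.proj t x) := by
      rw [h1, map_sum]
      simp
    rw [h2]
    refine (f.le_of_opNorm_le hf1 _).trans ?_
    rw [one_mul]
    exact (b.proj t).le_of_opNorm_le (hC t) x
  calc ‖∑ j ∈ Finset.range N, a j • b j‖ = ‖f (∑ j ∈ Finset.range N, a j • b j)‖ := by
        rw [hf]; simp
    _ ≤ ∑ j ∈ Finset.range N, ‖c j * f (b j)‖ := by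
        rw [map_sum]
        refine (norm_sum_le _ _).trans (Finset.sum_le_sum fun j _ => ?_)
        rw [map_smul, smul_eq_mul, norm_mul, norm_mul]
        exact mul_le_mul_of_nonneg_right (hac j) (norm_nonneg _)
    _ ≤ 4 * (C * ‖x‖) := sum_norm_le_four_mul hproj
    _ = 4 * C * ‖x‖ := by ring

theorem one_le_unconditionalConst : 1 ≤ unconditionalConst b :=
  le_csInf (exists_unconditional_bound b) fun _ h => le_of_unconditional_bound b h

theorem unconditionalConst_nonneg : 0 ≤ unconditionalConst b :=
  zero_le_one.trans (one_le_unconditionalConst b)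

theorem norm_sum_range_le (N : ℕ) (a c : ℕ → ℂ) (h : ∀ j, ‖a j‖ ≤ ‖c j‖) :
    ‖∑ j ∈ Finset.range N, a j • b j‖ ≤
      unconditionalConst b * ‖∑ j ∈ Finset.range N, c j • b j‖ := by
  -- The infimum is shown to be admissible itself by dividing by the norm on the right; when that
  -- norm vanishes, any admissible constant makes the left side vanish too.
  rcases eq_or_lt_of_le (norm_nonneg (∑ j ∈ Finset.range N, c j • b j)) with h0 | h0
  · obtain ⟨K, hK⟩ := exists_unconditional_bound b
    have := hK N a c h
    rw [← h0, mul_zero] at this ⊢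
    exact this
  · rw [← div_le_iff₀ h0]
    exact le_csInf (exists_unconditional_bound b) fun K hK => (div_le_iff₀ h0).2 (hK N a c h)

/-- Both coefficient families are padded with zeros up to a common range. -/
theorem norm_sum_smul_le {s t : Finset ℕ} (hst : s ⊆ t) {R : ℝ} {a c : ℕ → ℂ}
    (h : ∀ j ∈ s, ‖a j‖ ≤ R * ‖c j‖) (hR : 0 ≤ R) :
    ‖∑ j ∈ s, a j • b j‖ ≤ unconditionalConst b * R * ‖∑ j ∈ t, c j • b j‖ := by
  classical
  obtain ⟨N, hN⟩ := t.exists_nat_subset_range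
  have h1 := norm_sum_range_le b N (fun j => if j ∈ s then a j else 0)
    (fun j => if j ∈ t then (R : ℂ) * c j else 0) fun j => by
      by_cases hs : j ∈ s
      · simpa [hs, hst hs, abs_of_nonneg hR] using h j hs
      · rw [if_neg hs, norm_zero]
        exact norm_nonneg _
  simp only [ite_smul, zero_smul, Finset.sum_ite_mem, Finset.inter_eq_right.2 hN,
    Finset.inter_eq_right.2 (hst.trans hN), mul_smul, ← Finset.smul_sum] at h1
  rw [norm_smul, Complex.norm_real, Real.norm_of_nonneg hR, ← mul_assoc] at h1
  exact h1

/-- Limit of the previous bound as `t` exhausts the expansion of `x`. -/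
theorem norm_sum_smul_le_of_coord {s : Finset ℕ} {R : ℝ} {a : ℕ → ℂ} {x : X}
    (h : ∀ j ∈ s, ‖a j‖ ≤ R * ‖b.coord j x‖) (hR : 0 ≤ R) :
    ‖∑ j ∈ s, a j • b j‖ ≤ unconditionalConst b * R * ‖x‖ := by
  have hx : HasSum (fun j => b.coord j x • b j) x := b.expansion x
  refine ge_of_tendsto (hx.norm.const_mul (unconditionalConst b * R)) ?_
  filter_upwards [eventually_ge_atTop s] with t ht
  exact norm_sum_smul_le b ht h hR

theorem summable_diag (a : lp (fun _ : ℕ => ℂ) ∞) (x : X) :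
    Summable fun j => (a j * b.coord j x) • b j := by
  have hx : Summable (fun j => b.coord j x • b j) :=
    (show HasSum (fun j => b.coord j x • b j) x from b.expansion x).summable
  rw [summable_iff_vanishing_norm] at hx ⊢
  intro ε hε
  set C := unconditionalConst b * ‖a‖ with hC
  have hC0 : 0 ≤ C := mul_nonneg (unconditionalConst_nonneg b) (norm_nonneg _)
  -- The divisor is `C + 1` because `C` may be `0`.
  obtain ⟨s, hs⟩ := hx (ε / (C + 1)) (by positivity)
  refine ⟨s, fun t ht => ?_⟩
  have h1 : ‖∑ j ∈ t, (a j * b.coord j x) • b j‖ ≤ C * ‖∑ j ∈ t, b.coord j x • b j‖ := by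
    refine norm_sum_smul_le b subset_rfl (fun j _ => ?_) (norm_nonneg a)
    rw [norm_mul]
    exact mul_le_mul_of_nonneg_right (lp.norm_apply_le_norm ENNReal.top_ne_zero a j)
      (norm_nonneg _)
  have h2 := hs t ht
  rw [lt_div_iff₀ (by positivity)] at h2
  nlinarith [norm_nonneg (∑ j ∈ t, b.coord j x • b j)]

theorem norm_tsum_diag_le (a : lp (fun _ : ℕ => ℂ) ∞) (x : X) :
    ‖∑' j, (a j * b.coord j x) • b j‖ ≤ unconditionalConst b * ‖a‖ * ‖x‖ := by
  refine le_of_tendsto (summable_diag b a x).hasSum.norm (Eventually.of_forall fun t => ?_)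
  refine norm_sum_smul_le_of_coord b (fun j _ => ?_) (norm_nonneg a)
  rw [norm_mul]
  exact mul_le_mul_of_nonneg_right (lp.norm_apply_le_norm ENNReal.top_ne_zero a j)
    (norm_nonneg _)

/-- The diagonal operator on `X` with diagonal `a`. -/
noncomputable def diagX (a : lp (fun _ : ℕ => ℂ) ∞) : X →L[ℂ] X :=
  LinearMap.mkContinuous
    { toFun := fun x => ∑' j, (a j * b.coord j x) • b j
      map_add' := fun x y => by
        rw [← (summable_diag b a x).tsum_add (summable_diag b a y)]
        exact tsum_congr fun j => by rw [map_add, mul_add, add_smul]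
      map_smul' := fun c x => by
        rw [RingHom.id_apply, ← (summable_diag b a x).tsum_const_smul c]
        exact tsum_congr fun j => by rw [map_smul, smul_eq_mul, smul_smul, mul_left_comm] }
    (unconditionalConst b * ‖a‖) (norm_tsum_diag_le b a)

theorem norm_diagX_le (a : lp (fun _ : ℕ => ℂ) ∞) : ‖diagX b a‖ ≤ unconditionalConst b * ‖a‖ :=
  LinearMap.mkContinuous_norm_le _
    (mul_nonneg (unconditionalConst_nonneg b) (norm_nonneg _)) _

theorem coord_diagX (a : lp (fun _ : ℕ => ℂ) ∞) (x : X) (i : ℕ) :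
    b.coord i (diagX b a x) = a i * b.coord i x := by
  change b.coord i (∑' j, (a j * b.coord j x) • b j) = _
  rw [(b.coord i).map_tsum (summable_diag b a x), tsum_eq_single i]
  · simp [b.ortho]
  · intro j hj
    simp [b.ortho, hj.symm]

theorem diagX_basis (a : lp (fun _ : ℕ => ℂ) ∞) (i : ℕ) : diagX b a (b i) = a i • b i := by
  change ∑' j, (a j * b.coord j (b i)) • b j = _
  rw [tsum_eq_single i]
  · simp [b.ortho]
  · intro j hj
    simp [b.ortho, hj]

end UnconditionalConstant

/-! ### Maximum principle and the pairing `⟨F z, G (1 - z)⟩`. -/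

section Pairing

variable {X : Type*} [NormedAddCommGroup X] [NormedSpace ℂ X]
  (b : UnconditionalSchauderBasis ℕ ℂ X)

/-- The continuous functional giving the `j`-th coordinate on `X + X*`. -/
noncomputable def seqCoord (j : ℕ) : SumSpace b →L[ℂ] ℂ :=
  (ContinuousLinearMap.proj (R := ℂ) (φ := fun _ : ℕ => ℂ) j).comp
    ((sumKer b).liftQL (sumCoord b) le_rfl)

theorem seqCoord_apply (j : ℕ) (w : SumSpace b) : seqCoord b j w = toSeq b w j := by
  obtain ⟨p, rfl⟩ := Submodule.Quotient.mk_surjective (sumKer b) w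
  rfl

theorem toSeq_inclX (x : X) (j : ℕ) : toSeq b (inclX b x) j = b.coord j x := by
  change sumCoord b (x, 0) j = _
  rw [sumCoord_apply]
  simp

theorem toSeq_inclDual (f : StrongDual ℂ X) (j : ℕ) : toSeq b (inclDual b f) j = f (b j) := by
  change sumCoord b (0, f) j = _
  rw [sumCoord_apply]
  simp

theorem toSeq_injective : Function.Injective (toSeq b) := by
  rw [← LinearMap.ker_eq_bot]
  exact Submodule.ker_liftQ_eq_bot _ _ _ le_rfl

theorem closure_strip : closure strip = closedStrip := by
  rw [strip, closedStrip, Complex.closure_preimage_re, closure_Ioo zero_ne_one]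

theorem strip_subset_closedStrip : strip ⊆ closedStrip := fun _ hz => ⟨hz.1.le, hz.2.le⟩

theorem im_mul_I_mem_closedStrip (t : ℝ) : (t * Complex.I : ℂ) ∈ closedStrip := by
  constructor <;> simp

theorem one_add_im_mul_I_mem_closedStrip (t : ℝ) : (1 + t * Complex.I : ℂ) ∈ closedStrip := by
  constructor <;> simp

/-- The maximum principle on the strip and Cauchy's estimate for the derivative at `1/2`. -/
theorem norm_half_le_of_boundary {E : Type*} [NormedAddCommGroup E] [NormedSpace ℂ E]
    {h : ℂ → E} {C M : ℝ} (hd : DiffContOnCl ℂ h strip) (hM : ∀ z ∈ closedStrip, ‖h z‖ ≤ M)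
    (h0 : ∀ t : ℝ, ‖h (t * Complex.I)‖ ≤ C) (h1 : ∀ t : ℝ, ‖h (1 + t * Complex.I)‖ ≤ C) :
    ‖h (1 / 2)‖ ≤ C ∧ ‖deriv h (1 / 2)‖ ≤ 4 * C := by
  have hmax : ∀ z ∈ closedStrip, ‖h z‖ ≤ C := by
    intro z hz
    -- The bound `M` serves only as the growth hypothesis; the resulting constant `C` comes from the
    -- boundary alone.
    refine PhragmenLindelof.vertical_strip (a := 0) (b := 1) hd ⟨0, by simp [Real.pi_pos], 0, ?_⟩
      (fun w hw => ?_) (fun w hw => ?_) hz.1 hz.2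
    · simp only [zero_mul, Real.exp_zero]
      refine Asymptotics.IsBigO.of_bound M ?_
      refine Filter.Eventually.filter_mono inf_le_right ?_
      refine Filter.eventually_principal.2 fun w hw => ?_
      simpa using hM w ⟨hw.1.le, hw.2.le⟩
    · have hw' : w = (w.im : ℂ) * Complex.I := by apply Complex.ext <;> simp [hw]
      rw [hw']
      exact h0 _
    · have hw' : w = 1 + (w.im : ℂ) * Complex.I := by apply Complex.ext <;> simp [hw]
      rw [hw']
      exact h1 _
  have hsub : ∀ z ∈ Metric.closedBall (1 / 2 : ℂ) (1 / 4), z ∈ strip := by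
    intro z hz
    have h := (Complex.abs_re_le_norm (z - 1 / 2)).trans (mem_closedBall_iff_norm.1 hz)
    have h2 : (z - 1 / 2).re = z.re - 1 / 2 := by simp
    rw [h2, abs_le] at h
    constructor <;> linarith [h.1, h.2]
  refine ⟨hmax _ (strip_subset_closedStrip half_mem_strip), ?_⟩
  -- The factor 4 is the inverse of the radius `1/4` of a disc inside the strip.
  have := Complex.norm_deriv_le_of_forall_mem_sphere_norm_le (R := 1 / 4) (C := C) (c := 1 / 2)
    (f := h) (by norm_num) (hd.mono fun z hz => hsub z (Metric.ball_subset_closedBall hz))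
    fun z hz => hmax z (strip_subset_closedStrip (hsub z (Metric.sphere_subset_closedBall hz)))
  linarith

theorem hasDerivAt_toSeq (F : calderon b) (j : ℕ) :
    HasDerivAt (fun z => toSeq b (F.1.1 z) j) (derivHalf b F j) (1 / 2) := by
  have h := (seqCoord b j).hasFDerivAt.comp_hasDerivAt (1 / 2 : ℂ)
    (differentiableAt_half F).hasDerivAt
  simp only [Function.comp_def, seqCoord_apply] at h
  exact h

theorem diffContOnCl_toSeq (F : calderon b) (j : ℕ) :
    DiffContOnCl ℂ (fun z => toSeq b (F.1.1 z) j) strip := by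
  have h := (seqCoord b j).differentiable.comp_diffContOnCl F.2.1
  simp only [Function.comp_def, seqCoord_apply] at h
  exact h

theorem norm_toSeq_le (F : calderon b) (j : ℕ) {z : ℂ} (hz : z ∈ closedStrip) :
    ‖toSeq b (F.1.1 z) j‖ ≤ ‖seqCoord b j‖ * calderonNorm F := by
  rw [← seqCoord_apply]
  exact (seqCoord b j).le_opNorm_of_le (norm_le_calderonNorm F hz)

theorem one_sub_mem_strip {z : ℂ} (hz : z ∈ strip) : 1 - z ∈ strip := by
  have h1 : 0 < z.re := hz.1
  have h2 : z.re < 1 := hz.2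
  constructor
  · simpa using h2
  · simpa using h1

theorem one_sub_mem_closedStrip {z : ℂ} (hz : z ∈ closedStrip) : 1 - z ∈ closedStrip := by
  have h1 : 0 ≤ z.re := hz.1
  have h2 : z.re ≤ 1 := hz.2
  constructor
  · simpa using h2
  · simpa using h1

theorem diffContOnCl_comp_one_sub {E : Type*} [NormedAddCommGroup E] [NormedSpace ℂ E]
    {h : ℂ → E} (hd : DiffContOnCl ℂ h strip) :
    DiffContOnCl ℂ (fun z => h (1 - z)) strip :=
  hd.comp (g := fun z => 1 - z) (Differentiable.diffContOnCl (by fun_prop))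
    fun _ hz => one_sub_mem_strip hz

theorem norm_boundary_zero_le (F : calderon b) (t : ℝ) : ‖F.1.2.1 t‖ ≤ calderonNorm F :=
  (F.1.2.1.norm_coe_le_norm t).trans (le_max_left _ _)

theorem norm_boundary_one_le (F : calderon b) (t : ℝ) : ‖F.1.2.2 t‖ ≤ calderonNorm F :=
  (BoundedContinuousFunction.norm_coe_le_norm F.1.2.2 t).trans (le_max_right _ _)

variable [CompleteSpace X]

/-- The sum is `f` applied to a partial sum of `x`, and partial sum projections have norm at most
`K`. -/
theorem norm_sum_coord_mul_le (n : ℕ) (x : X) (f : StrongDual ℂ X) :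
    ‖∑ j ∈ Finset.range n, b.coord j x * f (b j)‖ ≤ unconditionalConst b * (‖x‖ * ‖f‖) := by
  have h : ∑ j ∈ Finset.range n, b.coord j x * f (b j) =
      f (∑ j ∈ Finset.range n, b.coord j x • b j) := by
    simp [map_sum]
  rw [h]
  refine (f.le_opNorm _).trans ?_
  have := norm_sum_smul_le_of_coord b (s := Finset.range n) (R := 1)
    (a := fun j => b.coord j x) (x := x) (fun j _ => by simp) zero_le_one
  calc ‖f‖ * _ ≤ ‖f‖ * (unconditionalConst b * 1 * ‖x‖) :=
        mul_le_mul_of_nonneg_left this (norm_nonneg f)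
    _ = _ := by ring

/-- The bilinear pairing of two functions of the Calderón space, `z ↦ ⟨F z, G (1 - z)⟩`, is
controlled by its boundary values. -/
theorem pairing_bounds (n : ℕ) (F G : calderon b) :
    ‖∑ j ∈ Finset.range n, evalHalf b F j * evalHalf b G j‖ ≤
        unconditionalConst b * (calderonNorm F * calderonNorm G) ∧
    ‖∑ j ∈ Finset.range n, (derivHalf b F j * evalHalf b G j - evalHalf b F j * derivHalf b G j)‖ ≤
        4 * (unconditionalConst b * (calderonNorm F * calderonNorm G)) := by
  -- The reflection `z ↦ 1 - z` exchanges the boundary lines, so on each of them one factor lies in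
  -- `X` and the other in `X*`. It fixes `1/2` and reverses the sign of the derivative of the second
  -- factor.
  set h : ℂ → ℂ := fun z =>
    ∑ j ∈ Finset.range n, toSeq b (F.1.1 z) j * toSeq b (G.1.1 (1 - z)) j with hh
  have hhalf : (1 - 1 / 2 : ℂ) = 1 / 2 := by norm_num
  have hderiv : HasDerivAt h (∑ j ∈ Finset.range n,
      (derivHalf b F j * evalHalf b G j - evalHalf b F j * derivHalf b G j)) (1 / 2) := by
    refine HasDerivAt.fun_sum fun j _ => ?_
    have hG : HasDerivAt (fun z => toSeq b (G.1.1 (1 - z)) j) (-derivHalf b G j) (1 / 2) := by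
      have := HasDerivAt.comp_const_sub (f := fun z => toSeq b (G.1.1 z) j) (1 : ℂ) (1 / 2)
        (by rw [hhalf]; exact hasDerivAt_toSeq b G j)
      exact this
    have := (hasDerivAt_toSeq b F j).mul hG
    rw [hhalf, mul_neg, ← sub_eq_add_neg] at this
    exact this
  have hdiff : DiffContOnCl ℂ h strip := by
    have : ∀ s : Finset ℕ, DiffContOnCl ℂ
        (fun z => ∑ j ∈ s, toSeq b (F.1.1 z) j * toSeq b (G.1.1 (1 - z)) j) strip := by
      intro s
      classical
      induction s using Finset.induction_on with
      | empty => simpa using diffContOnCl_const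
      | insert i s hi ih =>
        simp only [Finset.sum_insert hi]
        exact ((diffContOnCl_toSeq b F i).smul
          (diffContOnCl_comp_one_sub (diffContOnCl_toSeq b G i))).add ih
    exact this _
  have key := norm_half_le_of_boundary hdiff
    (C := unconditionalConst b * (calderonNorm F * calderonNorm G))
    (M := ∑ j ∈ Finset.range n,
      (‖seqCoord b j‖ * calderonNorm F) * (‖seqCoord b j‖ * calderonNorm G))
    (fun z hz => ?_) (fun t => ?_) (fun t => ?_)
  · rw [hderiv.deriv] at key
    refine ⟨?_, key.2⟩
    have h1 := key.1
    simp only [hh, hhalf] at h1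
    exact h1
  · refine (norm_sum_le _ _).trans (Finset.sum_le_sum fun j _ => ?_)
    rw [norm_mul]
    exact mul_le_mul (norm_toSeq_le b F j hz) (norm_toSeq_le b G j (one_sub_mem_closedStrip hz))
      (norm_nonneg _) (mul_nonneg (norm_nonneg _) (calderonNorm_nonneg F))
  · have e : (1 - t * Complex.I : ℂ) = 1 + ((-t : ℝ) : ℂ) * Complex.I := by push_cast; ring
    simp only [hh, e, F.2.2.2.1, G.2.2.2.2, toSeq_inclX, toSeq_inclDual]
    refine (norm_sum_coord_mul_le b n _ _).trans
      (mul_le_mul_of_nonneg_left ?_ (unconditionalConst_nonneg b))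
    exact mul_le_mul (norm_boundary_zero_le b F _) (norm_boundary_one_le b G _) (norm_nonneg _)
      (calderonNorm_nonneg F)
  · have e : (1 - (1 + t * Complex.I) : ℂ) = ((-t : ℝ) : ℂ) * Complex.I := by push_cast; ring
    simp only [hh, e, F.2.2.2.2, G.2.2.2.1, toSeq_inclX, toSeq_inclDual]
    simp only [mul_comm]
    refine (norm_sum_coord_mul_le b n _ _).trans
      (mul_le_mul_of_nonneg_left ?_ (unconditionalConst_nonneg b))
    rw [mul_comm (calderonNorm F)]
    exact mul_le_mul (norm_boundary_zero_le b G _) (norm_boundary_one_le b F _) (norm_nonneg _)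
      (calderonNorm_nonneg G)

end Pairing

/-! ### Operations on the Calderón space: multiplication, division by `z - 1/2`, diagonal action. -/

section Operations

variable {X : Type*} [NormedAddCommGroup X] [NormedSpace ℂ X]
  (b : UnconditionalSchauderBasis ℕ ℂ X)

theorem calderonNorm_le {F : calderon b} {C : ℝ} (hC : 0 ≤ C) (h0 : ∀ t, ‖F.1.2.1 t‖ ≤ C)
    (h1 : ∀ t, ‖F.1.2.2 t‖ ≤ C) : calderonNorm F ≤ C :=
  max_le ((BoundedContinuousFunction.norm_le hC).2 h0)
    ((BoundedContinuousFunction.norm_le (β := StrongDual ℂ X) hC).2 h1)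

/-- Construction of an element of the Calderón space from its boundary values. -/
theorem exists_calderon {f : ℂ → SumSpace b} {f0 : ℝ → X} {f1 : ℝ → StrongDual ℂ X} {C M : ℝ}
    (hd : DiffContOnCl ℂ f strip) (hM : ∀ z ∈ closedStrip, ‖f z‖ ≤ M)
    (h0 : ∀ t : ℝ, f (t * Complex.I) = inclX b (f0 t))
    (h1 : ∀ t : ℝ, f (1 + t * Complex.I) = inclDual b (f1 t))
    (hc0 : Continuous f0) (hc1 : Continuous f1) (hb0 : ∀ t, ‖f0 t‖ ≤ C) (hb1 : ∀ t, ‖f1 t‖ ≤ C) :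
    ∃ F : calderon b, F.1.1 = f ∧ calderonNorm F ≤ C :=
  ⟨⟨(f, BoundedContinuousFunction.ofNormedAddCommGroup f0 hc0 C hb0,
      BoundedContinuousFunction.ofNormedAddCommGroup f1 hc1 C hb1), hd, ⟨M, hM⟩, h0, h1⟩, rfl,
    calderonNorm_le b ((norm_nonneg _).trans (hb0 0)) hb0 hb1⟩

/-- Multiplication by a bounded analytic scalar function. -/
theorem exists_calderon_mul (F : calderon b) {ψ : ℂ → ℂ} (hψ : Differentiable ℂ ψ) {R : ℝ}
    (hR : ∀ z ∈ closedStrip, ‖ψ z‖ ≤ R) :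
    ∃ G : calderon b, (∀ z, G.1.1 z = ψ z • F.1.1 z) ∧ calderonNorm G ≤ R * calderonNorm F := by
  have hR0 : 0 ≤ R := (norm_nonneg _).trans (hR _ (im_mul_I_mem_closedStrip 0))
  obtain ⟨G, hG, hGn⟩ : ∃ G : calderon b, G.1.1 = (fun z => ψ z • F.1.1 z) ∧
      calderonNorm G ≤ R * calderonNorm F := by
    refine exists_calderon b
      (f0 := fun t : ℝ => ψ (t * Complex.I) • F.1.2.1 t)
      (f1 := fun t : ℝ => ψ (1 + t * Complex.I) • F.1.2.2 t)
      (C := R * calderonNorm F) (M := R * calderonNorm F)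
      (hψ.diffContOnCl.smul F.2.1) (fun z hz => ?_) (fun t => ?_) (fun t => ?_) ?_ ?_
      (fun t => ?_) (fun t => ?_)
    · rw [norm_smul]
      exact mul_le_mul (hR z hz) (norm_le_calderonNorm F hz) (norm_nonneg _) hR0
    · simp only [map_smul, F.2.2.2.1]
    · simp only [map_smul, F.2.2.2.2]
    · exact (hψ.continuous.comp (by fun_prop)).smul F.1.2.1.continuous
    · exact (hψ.continuous.comp (by fun_prop)).smul (map_continuous F.1.2.2)
    · rw [norm_smul]
      exact mul_le_mul (hR _ (im_mul_I_mem_closedStrip t))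
        ((F.1.2.1.norm_coe_le_norm t).trans (le_max_left _ _)) (norm_nonneg _) hR0
    · rw [norm_smul]
      exact mul_le_mul (hR _ (one_add_im_mul_I_mem_closedStrip t))
        ((BoundedContinuousFunction.norm_coe_le_norm F.1.2.2 t).trans (le_max_right _ _))
        (norm_nonneg _) hR0
  exact ⟨G, fun z => by rw [hG], hGn⟩

/-- A sequence which is the value at `1/2` of some `F` is also the derivative at `1/2` of a
function vanishing there. -/
theorem exists_calderon_deriv_eq (F : calderon b) :
    ∃ G : calderon b, evalHalf b G = 0 ∧ derivHalf b G = evalHalf b F ∧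
      calderonNorm G ≤ 3 * calderonNorm F := by
  -- A function with a simple zero at `1/2` and derivative 1 there. Unlike `z - 1/2` it is bounded
  -- on the strip, by `√e + 1 ≤ 3`.
  set ψ : ℂ → ℂ := fun z => Complex.exp (z - 1 / 2) - 1 with hψ
  have hd : HasDerivAt ψ 1 (1 / 2) := by
    have := (((hasDerivAt_id (1 / 2 : ℂ)).sub_const (1 / 2)).cexp).sub_const 1
    rw [id, sub_self, Complex.exp_zero, one_mul] at this
    exact this
  obtain ⟨G, hG, hGn⟩ := exists_calderon_mul b F (ψ := ψ) (by fun_prop) (R := 3) fun z hz => by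
    have h1 : Real.exp ((z - 1 / 2).re) ≤ 2 := by
      have h2 : (z - 1 / 2).re ≤ 1 / 2 := by
        have : z.re ≤ 1 := hz.2
        simp only [Complex.sub_re, Complex.div_ofNat_re, Complex.one_re]
        linarith
      refine (Real.exp_le_exp.2 h2).trans ?_
      have h3 : Real.exp (1 / 2) * Real.exp (1 / 2) = Real.exp 1 := by
        rw [← Real.exp_add]; norm_num
      nlinarith [Real.exp_one_lt_d9, Real.exp_pos (1 / 2)]
    calc ‖ψ z‖ ≤ ‖Complex.exp (z - 1 / 2)‖ + ‖(1 : ℂ)‖ := norm_sub_le _ _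
      _ ≤ 3 := by rw [Complex.norm_exp, norm_one]; linarith
  have hG' : G.1.1 = fun z => ψ z • F.1.1 z := funext hG
  refine ⟨G, ?_, ?_, hGn⟩
  · change toSeq b (G.1.1 (1 / 2)) = 0
    simp [hG, hψ]
  · change toSeq b (deriv G.1.1 (1 / 2)) = toSeq b (F.1.1 (1 / 2))
    rw [hG', (hd.fun_smul (differentiableAt_half F).hasDerivAt).deriv]
    simp [hψ]

theorem norm_sub_half_ge_of_boundary {z : ℂ} (h : |z.re - 1 / 2| = 1 / 2) :
    1 / 2 ≤ ‖z - 1 / 2‖ := by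
  have := Complex.abs_re_le_norm (z - 1 / 2)
  simp only [Complex.sub_re, Complex.div_ofNat_re, Complex.one_re] at this
  rwa [h] at this

variable [CompleteSpace X]

/-- Completeness is what the removable singularity theorem needs for functions with values in `X +
X*`. -/
instance : CompleteSpace (SumSpace b) :=
  inferInstanceAs (CompleteSpace ((X × StrongDual ℂ X) ⧸ sumKer b))

/-- If `F (1/2) = 0`, then `F' (1/2)` is the value at `1/2` of `F z / (z - 1/2)`. -/
theorem exists_calderon_eval_eq (F : calderon b) (hF : F.1.1 (1 / 2) = 0) :
    ∃ G : calderon b, evalHalf b G = derivHalf b F ∧ calderonNorm G ≤ 2 * calderonNorm F := by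
  -- The quotient with its removable singularity filled in by `F' (1/2)`.
  set f := dslope F.1.1 (1 / 2) with hf
  have hne : ∀ z : ℂ, z ≠ 1 / 2 → f z = (z - 1 / 2)⁻¹ • F.1.1 z := by
    intro z hz
    rw [hf, dslope_of_ne _ hz, slope_def_module, hF, sub_zero]
  have hdiff : DiffContOnCl ℂ f strip := by
    refine ⟨(Complex.differentiableOn_dslope (isOpen_strip.mem_nhds half_mem_strip)).2
      F.2.1.differentiableOn, ?_⟩
    rw [hf, continuousOn_dslope (mem_of_superset (isOpen_strip.mem_nhds half_mem_strip)
      subset_closure)]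
    exact ⟨F.2.1.continuousOn, differentiableAt_half F⟩
  have hsub : Metric.closedBall (1 / 2 : ℂ) (1 / 4) ⊆ closedStrip := by
    intro z hz
    have h := (Complex.abs_re_le_norm (z - 1 / 2)).trans (mem_closedBall_iff_norm.1 hz)
    have h2 : (z - 1 / 2).re = z.re - 1 / 2 := by simp
    rw [h2, abs_le] at h
    constructor <;> linarith [h.1, h.2]
  -- Boundedness of the quotient: compactness near `1/2`, and `|z - 1/2| > 1/4` elsewhere. Only the
  -- boundary, at distance at least `1/2`, enters the norm estimate, hence the factor 2.
  obtain ⟨M, hM⟩ := (isCompact_closedBall (1 / 2 : ℂ) (1 / 4)).exists_bound_of_continuousOn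
    (hdiff.continuousOn.mono (by rw [closure_strip]; exact hsub))
  have hn0 : ∀ t : ℝ, 1 / 2 ≤ ‖(t * Complex.I - 1 / 2 : ℂ)‖ := fun t =>
    norm_sub_half_ge_of_boundary (by norm_num)
  have hn1 : ∀ t : ℝ, 1 / 2 ≤ ‖(1 + t * Complex.I - 1 / 2 : ℂ)‖ := fun t =>
    norm_sub_half_ge_of_boundary (by norm_num)
  have hne0 : ∀ t : ℝ, (t * Complex.I - 1 / 2 : ℂ) ≠ 0 := fun t h => by
    have := hn0 t
    rw [h, norm_zero] at this
    norm_num at this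
  have hne1 : ∀ t : ℝ, (1 + t * Complex.I - 1 / 2 : ℂ) ≠ 0 := fun t h => by
    have := hn1 t
    rw [h, norm_zero] at this
    norm_num at this
  have hinv : ∀ w : ℂ, 1 / 2 ≤ ‖w‖ → ‖w⁻¹‖ ≤ 2 := fun w hw => by
    rw [norm_inv]
    exact inv_le_of_inv_le₀ (by norm_num) (by linarith)
  obtain ⟨G, hG, hGn⟩ : ∃ G : calderon b, G.1.1 = f ∧ calderonNorm G ≤ 2 * calderonNorm F := by
    refine exists_calderon b
      (f0 := fun t : ℝ => (t * Complex.I - 1 / 2 : ℂ)⁻¹ • F.1.2.1 t)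
      (f1 := fun t : ℝ => (1 + t * Complex.I - 1 / 2 : ℂ)⁻¹ • F.1.2.2 t)
      (C := 2 * calderonNorm F) (M := max M (4 * calderonNorm F))
      hdiff (fun z hz => ?_) (fun t => ?_) (fun t => ?_) ?_ ?_ (fun t => ?_) (fun t => ?_)
    · by_cases hzb : z ∈ Metric.closedBall (1 / 2 : ℂ) (1 / 4)
      · exact (hM z hzb).trans (le_max_left _ _)
      · have h1 : 1 / 4 < ‖z - 1 / 2‖ := by
          rw [mem_closedBall_iff_norm, not_le] at hzb
          exact hzb
        have h2 : z ≠ 1 / 2 := fun h => by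
          rw [h, sub_self, norm_zero] at h1
          norm_num at h1
        rw [hne z h2, norm_smul, norm_inv]
        refine le_trans ?_ (le_max_right _ _)
        exact mul_le_mul (inv_le_of_inv_le₀ (by norm_num) (by linarith)) (norm_le_calderonNorm F hz)
          (norm_nonneg _) (by norm_num)
    · rw [hne _ (sub_ne_zero.1 (hne0 t)), map_smul, F.2.2.2.1]
    · rw [hne _ (sub_ne_zero.1 (hne1 t)), map_smul, F.2.2.2.2]
    · exact (Continuous.inv₀ (by fun_prop) hne0).smul F.1.2.1.continuous
    · exact (Continuous.inv₀ (by fun_prop) hne1).smul F.1.2.2.continuous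
    · rw [norm_smul]
      exact mul_le_mul (hinv _ (hn0 t))
        ((F.1.2.1.norm_coe_le_norm t).trans (le_max_left _ _)) (norm_nonneg _) (by norm_num)
    · rw [norm_smul]
      exact mul_le_mul (hinv _ (hn1 t))
        ((BoundedContinuousFunction.norm_coe_le_norm F.1.2.2 t).trans (le_max_right _ _))
        (norm_nonneg _) (by norm_num)
  refine ⟨G, ?_, hGn⟩
  change toSeq b (G.1.1 (1 / 2)) = toSeq b (deriv F.1.1 (1 / 2))
  rw [hG, hf, dslope_same]

/-- The diagonal operator on `X*` with diagonal `a`, the adjoint of the one on `X`. -/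
noncomputable def diagDual (a : lp (fun _ : ℕ => ℂ) ∞) : StrongDual ℂ X →L[ℂ] StrongDual ℂ X :=
  (ContinuousLinearMap.compL ℂ X X ℂ).flip (diagX b a)

theorem diagDual_apply (a : lp (fun _ : ℕ => ℂ) ∞) (f : StrongDual ℂ X) (x : X) :
    diagDual b a f x = f (diagX b a x) := rfl

theorem norm_diagDual_apply_le (a : lp (fun _ : ℕ => ℂ) ∞) (f : StrongDual ℂ X) :
    ‖diagDual b a f‖ ≤ unconditionalConst b * ‖a‖ * ‖f‖ := by
  refine ContinuousLinearMap.opNorm_le_bound _ (mul_nonneg (mul_nonneg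
    (unconditionalConst_nonneg b) (norm_nonneg _)) (norm_nonneg _)) fun x => ?_
  rw [diagDual_apply]
  refine (f.le_opNorm _).trans ?_
  calc ‖f‖ * ‖diagX b a x‖ ≤ ‖f‖ * (unconditionalConst b * ‖a‖ * ‖x‖) :=
        mul_le_mul_of_nonneg_left ((diagX b a).le_of_opNorm_le (norm_diagX_le b a) x)
          (norm_nonneg f)
    _ = _ := by ring

/-- The two diagonal operators multiply the same sequence coordinates, so together they preserve
`sumKer b` and descend to `X + X*`. -/
theorem sumCoord_diag (a : lp (fun _ : ℕ => ℂ) ∞) (p : X × StrongDual ℂ X) :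
    sumCoord b (diagX b a p.1, diagDual b a p.2) = ⇑a * sumCoord b p := by
  ext j
  rw [sumCoord_apply, Pi.mul_apply, sumCoord_apply, coord_diagX, diagDual_apply, diagX_basis,
    map_smul, smul_eq_mul, mul_add]

/-- The diagonal operator on `X + X*` with diagonal `a`. -/
noncomputable def diagSum (a : lp (fun _ : ℕ => ℂ) ∞) : SumSpace b →L[ℂ] SumSpace b :=
  (sumKer b).liftQL ((sumKer b).mkQL.comp ((diagX b a).prodMap (diagDual b a))) fun p hp => by
    refine LinearMap.mem_ker.2 ((Submodule.Quotient.mk_eq_zero (sumKer b)).2 ?_)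
    refine LinearMap.mem_ker.2 ?_
    have h := sumCoord_diag b a p
    rw [show sumCoord b p = 0 from LinearMap.mem_ker.1 hp, mul_zero] at h
    exact h

theorem diagSum_inclX (a : lp (fun _ : ℕ => ℂ) ∞) (x : X) :
    diagSum b a (inclX b x) = inclX b (diagX b a x) := by
  change (sumKer b).mkQ (diagX b a x, diagDual b a 0) = (sumKer b).mkQ (diagX b a x, 0)
  rw [map_zero]

theorem diagSum_inclDual (a : lp (fun _ : ℕ => ℂ) ∞) (f : StrongDual ℂ X) :
    diagSum b a (inclDual b f) = inclDual b (diagDual b a f) := by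
  change (sumKer b).mkQ (diagX b a 0, diagDual b a f) = (sumKer b).mkQ (0, diagDual b a f)
  rw [map_zero]

theorem toSeq_diagSum (a : lp (fun _ : ℕ => ℂ) ∞) (w : SumSpace b) :
    toSeq b (diagSum b a w) = ⇑a * toSeq b w := by
  obtain ⟨p, rfl⟩ := Submodule.Quotient.mk_surjective (sumKer b) w
  exact sumCoord_diag b a p

/-- The action of a bounded sequence on the Calderón space. -/
theorem exists_calderon_diag (a : lp (fun _ : ℕ => ℂ) ∞) (F : calderon b) :
    ∃ G : calderon b, evalHalf b G = ⇑a * evalHalf b F ∧ derivHalf b G = ⇑a * derivHalf b F ∧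
      calderonNorm G ≤ unconditionalConst b * ‖a‖ * calderonNorm F := by
  have hK : 0 ≤ unconditionalConst b * ‖a‖ :=
    mul_nonneg (unconditionalConst_nonneg b) (norm_nonneg _)
  obtain ⟨G, hG, hGn⟩ := exists_calderon b (f := fun z => diagSum b a (F.1.1 z))
    (f0 := fun t => diagX b a (F.1.2.1 t)) (f1 := fun t => diagDual b a (F.1.2.2 t))
    (C := unconditionalConst b * ‖a‖ * calderonNorm F) (M := ‖diagSum b a‖ * calderonNorm F)
    ((diagSum b a).differentiable.comp_diffContOnCl F.2.1)
    (fun z hz => (diagSum b a).le_opNorm_of_le (norm_le_calderonNorm F hz))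
    (fun t => by rw [F.2.2.2.1, diagSum_inclX]) (fun t => by rw [F.2.2.2.2, diagSum_inclDual])
    ((diagX b a).continuous.comp F.1.2.1.continuous)
    ((diagDual b a).continuous.comp F.1.2.2.continuous)
    (fun t => ((diagX b a).le_of_opNorm_le (norm_diagX_le b a) _).trans
      (mul_le_mul_of_nonneg_left (norm_boundary_zero_le b F t) hK))
    (fun t => (norm_diagDual_apply_le b a _).trans
      (mul_le_mul_of_nonneg_left (norm_boundary_one_le b F t) hK))
  refine ⟨G, ?_, ?_, hGn⟩
  · change toSeq b (G.1.1 (1 / 2)) = _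
    rw [hG, toSeq_diagSum]
    rfl
  · change toSeq b (deriv G.1.1 (1 / 2)) = _
    have hd := (diagSum b a).hasFDerivAt.comp_hasDerivAt (1 / 2 : ℂ)
      (differentiableAt_half F).hasDerivAt
    rw [hG]
    change toSeq b (deriv (⇑(diagSum b a) ∘ F.1.1) (1 / 2)) = _
    rw [hd.deriv, toSeq_diagSum]
    rfl

end Operations

/-! ### The Euclidean norm on the first `n` coordinates. -/

section EuclideanNorm

/-- The Euclidean norm of the first `n` terms of a sequence. -/
noncomputable def l2Norm (n : ℕ) (x : ℕ → ℂ) : ℝ := √(∑ j ∈ Finset.range n, ‖x j‖ ^ 2)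

theorem l2Norm_nonneg (n : ℕ) (x : ℕ → ℂ) : 0 ≤ l2Norm n x := Real.sqrt_nonneg _

theorem l2Norm_sq (n : ℕ) (x : ℕ → ℂ) : l2Norm n x ^ 2 = ∑ j ∈ Finset.range n, ‖x j‖ ^ 2 :=
  Real.sq_sqrt (Finset.sum_nonneg fun _ _ => sq_nonneg _)

theorem norm_sum_mul_le_l2Norm (n : ℕ) (x y : ℕ → ℂ) :
    ‖∑ j ∈ Finset.range n, x j * y j‖ ≤ l2Norm n x * l2Norm n y := by
  refine (norm_sum_le _ _).trans ?_
  simp only [norm_mul]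
  exact Real.sum_mul_le_sqrt_mul_sqrt _ _ _

/-- Self-duality of the Euclidean norm, tested on the conjugate of `x`. Only supported `y` are
needed, and these are the sequences that can be lifted to the Calderón space. -/
theorem l2Norm_le_of_forall {n : ℕ} {x : ℕ → ℂ} {C : ℝ} (hC : 0 ≤ C)
    (h : ∀ y : ℕ → ℂ, (∀ j, n ≤ j → y j = 0) →
      ‖∑ j ∈ Finset.range n, x j * y j‖ ≤ C * l2Norm n y) : l2Norm n x ≤ C := by
  set y : ℕ → ℂ := fun j => if j < n then (starRingEnd ℂ) (x j) else 0 with hy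
  have h1 := h y fun j hj => if_neg (not_lt.2 hj)
  have h2 : ∑ j ∈ Finset.range n, x j * y j = ((l2Norm n x ^ 2 : ℝ) : ℂ) := by
    rw [l2Norm_sq, Complex.ofReal_sum]
    refine Finset.sum_congr rfl fun j hj => ?_
    rw [hy]
    simp only [if_pos (Finset.mem_range.1 hj), Complex.mul_conj, Complex.normSq_eq_norm_sq]
  have h3 : l2Norm n y = l2Norm n x := by
    unfold l2Norm
    congr 1
    refine Finset.sum_congr rfl fun j hj => ?_
    rw [hy]
    simp only [if_pos (Finset.mem_range.1 hj), RCLike.norm_conj]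
  rw [h2, h3, Complex.norm_real, Real.norm_of_nonneg (sq_nonneg _), sq] at h1
  rcases eq_or_lt_of_le (l2Norm_nonneg n x) with h0 | h0
  · rw [← h0]
    exact hC
  · exact le_of_mul_le_mul_right h1 h0

theorem l2Norm_add_le (n : ℕ) (x y : ℕ → ℂ) : l2Norm n (x + y) ≤ l2Norm n x + l2Norm n y := by
  refine l2Norm_le_of_forall (add_nonneg (l2Norm_nonneg n x) (l2Norm_nonneg n y)) fun z _ => ?_
  simp only [Pi.add_apply, add_mul, Finset.sum_add_distrib]
  exact (norm_add_le _ _).trans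
    (add_le_add (norm_sum_mul_le_l2Norm n x z) (norm_sum_mul_le_l2Norm n y z))

theorem l2Norm_le_mul {n : ℕ} {x y : ℕ → ℂ} {R : ℝ} (hR : 0 ≤ R)
    (h : ∀ j < n, ‖x j‖ ≤ R * ‖y j‖) : l2Norm n x ≤ R * l2Norm n y := by
  refine Real.sqrt_le_iff.2 ⟨mul_nonneg hR (l2Norm_nonneg n y), ?_⟩
  rw [mul_pow, l2Norm_sq, Finset.mul_sum]
  refine Finset.sum_le_sum fun j hj => ?_
  rw [← mul_pow]
  exact pow_le_pow_left₀ (norm_nonneg _) (h j (Finset.mem_range.1 hj)) 2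

theorem norm_le_l2Norm {n j : ℕ} (hj : j < n) (x : ℕ → ℂ) : ‖x j‖ ≤ l2Norm n x :=
  Real.le_sqrt_of_sq_le (Finset.single_le_sum (f := fun j => ‖x j‖ ^ 2)
    (fun _ _ => sq_nonneg _) (Finset.mem_range.2 hj))

theorem eq_zero_of_l2Norm_eq_zero {n : ℕ} {x : ℕ → ℂ} (hx : ∀ j, n ≤ j → x j = 0)
    (h : l2Norm n x = 0) : x = 0 := by
  ext j
  rcases lt_or_ge j n with hj | hj
  · exact norm_le_zero_iff.1 ((norm_le_l2Norm hj x).trans h.le)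
  · exact hx j hj

end EuclideanNorm

/-! ### Lozanovskii factorization and the comparison of `(X, X*)_{1/2}` with `ℓ₂`. -/

section Factorization

variable {X : Type*} [NormedAddCommGroup X] [NormedSpace ℂ X]
  (b : UnconditionalSchauderBasis ℕ ℂ X)

theorem coord_sum_smul (s : Finset ℕ) (c : ℕ → ℂ) (i : ℕ) :
    b.coord i (∑ j ∈ s, c j • b j) = if i ∈ s then c i else 0 := by
  simp [map_sum, b.ortho, Pi.single_apply]

/-- Lozanovskii's factorization of a finite positive weight `w`, obtained by maximizing
`∏ aⱼ ^ wⱼ` over the positive part of the unit ball. -/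
theorem exists_factorization (s : Finset ℕ) (w : ℕ → ℝ) (hw : ∀ j ∈ s, 0 < w j) :
    ∃ a : ℕ → ℝ, (∀ j ∈ s, 0 < a j) ∧ ‖∑ j ∈ s, (a j : ℂ) • b j‖ ≤ 1 ∧
      ∀ (c : ℕ → ℝ) (M : ℝ), (∀ j ∈ s, 0 ≤ c j) → 0 < M → ‖∑ j ∈ s, (c j : ℂ) • b j‖ ≤ M →
        ∑ j ∈ s, w j / a j * c j ≤ (∑ j ∈ s, w j) * M := by
  classical
  set S : Set (ℕ → ℝ) := (Set.univ.pi fun j => Set.Icc 0 ‖b.coord j‖) ∩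
    {a | ‖∑ j ∈ s, (a j : ℂ) • b j‖ ≤ 1} with hS
  have hcompact : IsCompact S := by
    refine (isCompact_univ_pi fun j => isCompact_Icc).inter_right ?_
    exact isClosed_le (by fun_prop) continuous_const
  have hmem : ∀ c : ℕ → ℝ, (∀ j ∈ s, 0 ≤ c j) → ‖∑ j ∈ s, (c j : ℂ) • b j‖ ≤ 1 →
      (fun j => if j ∈ s then c j else 0) ∈ S := by
    intro c hc hc1
    refine ⟨fun j _ => ?_, ?_⟩
    · by_cases hj : j ∈ s
      · simp only [if_pos hj]
        refine ⟨hc j hj, ?_⟩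
        have h1 := (b.coord j).le_opNorm_of_le hc1
        rw [coord_sum_smul, if_pos hj, Complex.norm_real, Real.norm_of_nonneg (hc j hj),
          mul_one] at h1
        exact h1
      · simp [hj]
    · change ‖∑ j ∈ s, ((if j ∈ s then c j else 0 : ℝ) : ℂ) • b j‖ ≤ 1
      rw [Finset.sum_congr rfl fun j hj => by rw [if_pos hj]]
      exact hc1
  -- A small constant vector lies in the ball, so the maximum is positive and no coordinate of the
  -- maximizer on `s` vanishes.
  set ε : ℝ := (1 + ‖∑ j ∈ s, b j‖)⁻¹ with hε
  have hε0 : 0 < ε := by positivity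
  have hstart : (fun j => if j ∈ s then ε else 0) ∈ S := by
    refine hmem (fun _ => ε) (fun _ _ => hε0.le) ?_
    rw [← Finset.smul_sum, norm_smul, Complex.norm_real, Real.norm_of_nonneg hε0.le, hε,
      inv_mul_le_iff₀ (by positivity)]
    linarith
  set f : (ℕ → ℝ) → ℝ := fun a => ∏ j ∈ s, a j ^ w j with hf
  have hfc : Continuous f := continuous_finsetProd _ fun j hj =>
    (continuous_apply j).rpow_const fun _ => Or.inr (hw j hj).le
  obtain ⟨a, haS, hmax⟩ := hcompact.exists_isMaxOn ⟨_, hstart⟩ hfc.continuousOn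
  have hfpos : 0 < f a := by
    refine lt_of_lt_of_le ?_ (hmax hstart)
    refine Finset.prod_pos fun j hj => ?_
    simp only [if_pos hj]
    exact Real.rpow_pos_of_pos hε0 _
  have hpos : ∀ j ∈ s, 0 < a j := by
    intro j hj
    refine lt_of_le_of_ne (haS.1 j trivial).1 fun h => ?_
    refine hfpos.ne' (Finset.prod_eq_zero hj ?_)
    rw [← h, Real.zero_rpow (hw j hj).ne']
  have hlog : ∀ u : ℕ → ℝ, (∀ j ∈ s, 0 < u j) → Real.log (f u) = ∑ j ∈ s, w j * Real.log (u j) := by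
    intro u hu
    rw [hf, Real.log_prod fun j hj => (Real.rpow_pos_of_pos (hu j hj) _).ne']
    exact Finset.sum_congr rfl fun j hj => Real.log_rpow (hu j hj) _
  have hvar : ∀ c : ℕ → ℝ, (∀ j ∈ s, 0 ≤ c j) → ‖∑ j ∈ s, (c j : ℂ) • b j‖ ≤ 1 →
      ∑ j ∈ s, w j / a j * c j ≤ ∑ j ∈ s, w j := by
    intro c hc hc1
    -- The maximizer `a` is compared with `a + t (c - a)`, which stays in the ball by convexity. The
    -- inequality `log x ≥ 1 - 1/x` makes the comparison of logarithms linear in `c - a` up to the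
    -- denominators, and `t → 0` gives the first-order condition.
    have hineq : ∀ t : ℝ, 0 < t → t < 1 →
        ∑ j ∈ s, w j * ((c j - a j) / (a j + t * (c j - a j))) ≤ 0 := by
      intro t ht ht1
      set u : ℕ → ℝ := fun j => a j + t * (c j - a j) with hu
      have hupos : ∀ j ∈ s, 0 < u j := fun j hj => by
        have h1 : u j = (1 - t) * a j + t * c j := by rw [hu]; ring
        rw [h1]
        have := mul_pos (sub_pos.2 ht1) (hpos j hj)
        have := mul_nonneg ht.le (hc j hj)
        linarith
      have hunorm : ‖∑ j ∈ s, (u j : ℂ) • b j‖ ≤ 1 := by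
        have h1 : ∑ j ∈ s, (u j : ℂ) • b j = ((1 - t : ℝ) : ℂ) • ∑ j ∈ s, (a j : ℂ) • b j +
            (t : ℂ) • ∑ j ∈ s, (c j : ℂ) • b j := by
          rw [Finset.smul_sum, Finset.smul_sum, ← Finset.sum_add_distrib]
          refine Finset.sum_congr rfl fun j _ => ?_
          rw [smul_smul, smul_smul, ← add_smul, hu]
          congr 1
          push_cast
          ring
        rw [h1]
        refine (norm_add_le _ _).trans ?_
        rw [norm_smul, norm_smul, Complex.norm_real, Complex.norm_real,
          Real.norm_of_nonneg ht.le, Real.norm_of_nonneg (sub_pos.2 ht1).le]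
        have h2 := mul_le_mul_of_nonneg_left haS.2 (sub_pos.2 ht1).le
        have h3 := mul_le_mul_of_nonneg_left hc1 ht.le
        linarith
      have hfu : f u ≤ f a := by
        have h1 := hmax (hmem u (fun j hj => (hupos j hj).le) hunorm)
        have h2 : f (fun j => if j ∈ s then u j else 0) = f u :=
          Finset.prod_congr rfl fun j hj => by simp only [if_pos hj]
        rw [Set.mem_ofPred_eq, h2] at h1
        exact h1
      have h1 := Real.log_le_log (Finset.prod_pos fun j hj =>
        Real.rpow_pos_of_pos (hupos j hj) _) hfu
      rw [hlog u hupos, hlog a hpos, ← sub_nonpos, ← Finset.sum_sub_distrib] at h1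
      refine nonpos_of_mul_nonpos_right (le_trans ?_ h1) ht
      rw [Finset.mul_sum]
      refine Finset.sum_le_sum fun j hj => ?_
      rw [← mul_sub, ← Real.log_div (hupos j hj).ne' (hpos j hj).ne', mul_left_comm]
      refine mul_le_mul_of_nonneg_left ?_ (hw j hj).le
      refine le_trans (le_of_eq ?_)
        (Real.one_sub_inv_le_log_of_pos (div_pos (hupos j hj) (hpos j hj)))
      have h3 := (hupos j hj).ne'
      rw [inv_div]
      change t * ((c j - a j) / u j) = 1 - a j / u j
      field_simp
      rw [hu]
      ring
    have hlim : Tendsto (fun t : ℝ => ∑ j ∈ s, w j * ((c j - a j) / (a j + t * (c j - a j))))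
        (𝓝[>] 0) (𝓝 (∑ j ∈ s, w j * ((c j - a j) / (a j + 0 * (c j - a j))))) := by
      refine tendsto_nhdsWithin_of_tendsto_nhds (tendsto_finsetSum _ fun j hj => ?_)
      refine Tendsto.const_mul _ (Tendsto.div tendsto_const_nhds ?_ ?_)
      · exact Continuous.tendsto (by fun_prop) 0
      · simpa using (hpos j hj).ne'
    have h0 := le_of_tendsto hlim (b := 0) (by
      filter_upwards [Ioo_mem_nhdsGT (zero_lt_one (α := ℝ))] with t ht
      exact hineq t ht.1 ht.2)
    have h1 : ∑ j ∈ s, w j * ((c j - a j) / (a j + 0 * (c j - a j))) =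
        ∑ j ∈ s, w j / a j * c j - ∑ j ∈ s, w j := by
      rw [← Finset.sum_sub_distrib]
      refine Finset.sum_congr rfl fun j hj => ?_
      have := (hpos j hj).ne'
      rw [zero_mul, add_zero]
      field_simp
    linarith
  refine ⟨a, hpos, haS.2, fun c M hc hM hcM => ?_⟩
  have h1 := hvar (fun j => c j / M) (fun j hj => div_nonneg (hc j hj) hM.le) (by
    have h2 : ∑ j ∈ s, ((c j / M : ℝ) : ℂ) • b j = ((M⁻¹ : ℝ) : ℂ) • ∑ j ∈ s, (c j : ℂ) • b j := by
      rw [Finset.smul_sum]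
      refine Finset.sum_congr rfl fun j _ => ?_
      rw [smul_smul]
      congr 1
      push_cast
      ring
    rw [h2, norm_smul, Complex.norm_real, Real.norm_of_nonneg (inv_nonneg.2 hM.le),
      inv_mul_le_iff₀ hM, mul_one]
    exact hcM)
  have h2 : ∑ j ∈ s, w j / a j * (c j / M) = (∑ j ∈ s, w j / a j * c j) / M := by
    rw [Finset.sum_div]
    exact Finset.sum_congr rfl fun j _ => by ring
  rw [h2, div_le_iff₀ hM] at h1
  exact h1

theorem interpENorm_lt_iff (x : ℕ → ℂ) (c : ℝ≥0∞) :
    interpENorm b x < c ↔ ∃ F : calderon b, evalHalf b F = x ∧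
      ENNReal.ofReal (calderonNorm F) < c := by
  simp only [interpENorm, iInf_lt_iff, exists_prop]

theorem interpENorm_evalHalf_le (F : calderon b) :
    interpENorm b (evalHalf b F) ≤ ENNReal.ofReal (calderonNorm F) :=
  iInf₂_le (f := fun (G : calderon b) (_ : evalHalf b G = evalHalf b F) =>
    ENNReal.ofReal (calderonNorm G)) F rfl

variable [CompleteSpace X]

theorem norm_mul_exp (x : ℂ) (l : ℝ) (z : ℂ) :
    ‖x * Complex.exp ((1 - 2 * z) * l)‖ = ‖x‖ * Real.exp ((1 - 2 * z.re) * l) := by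
  rw [norm_mul, Complex.norm_exp]
  simp

/-- A finitely supported sequence is the value at `1/2` of a function of the Calderón space with
the same support, whose norm is controlled by the Euclidean norm. -/
theorem exists_calderon_of_support {n : ℕ} {x : ℕ → ℂ} (hx : ∀ j, n ≤ j → x j = 0) :
    ∃ F : calderon b, evalHalf b F = x ∧ (∀ j, n ≤ j → derivHalf b F j = 0) ∧
      calderonNorm F ≤ unconditionalConst b * l2Norm n x := by
  classical
  -- Restriction to the support of `x` makes the weights `‖x j‖ ^ 2` strictly positive.
  set s : Finset ℕ := (Finset.range n).filter fun j => x j ≠ 0 with hs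
  have hxs : ∀ j ∉ s, x j = 0 := by
    intro j hj
    by_contra h
    refine hj (Finset.mem_filter.2 ⟨Finset.mem_range.2 ?_, h⟩)
    by_contra h'
    exact h (hx j (not_lt.1 h'))
  have hxpos : ∀ j ∈ s, 0 < ‖x j‖ := fun j hj => norm_pos_iff.2 (Finset.mem_filter.1 hj).2
  have hsum : ∑ j ∈ s, ‖x j‖ ^ 2 = l2Norm n x ^ 2 := by
    rw [l2Norm_sq]
    refine Finset.sum_subset (Finset.filter_subset _ _) fun j _ hj => ?_
    rw [hxs j hj, norm_zero]
    norm_num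
  obtain ⟨a, ha, ha1, hdual⟩ := exists_factorization b s (fun j => ‖x j‖ ^ 2)
    fun j hj => pow_pos (hxpos j hj) 2
  set r := l2Norm n x with hr
  have hr0 : 0 ≤ r := l2Norm_nonneg n x
  have hrpos : ∀ j ∈ s, 0 < r := fun j hj =>
    (hxpos j hj).trans_le (norm_le_l2Norm (Finset.mem_range.1 (Finset.mem_filter.1 hj).1) x)
  -- With this exponent the modulus of the `j`-th coordinate is `r a j` on the left line and `‖x j‖²
  -- / (r a j)` on the right one, while the value at `1/2` is `x j`.
  set l : ℕ → ℝ := fun j => Real.log (r * a j / ‖x j‖) with hl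
  have hquot : ∀ j ∈ s, 0 < r * a j / ‖x j‖ := fun j hj =>
    div_pos (mul_pos (hrpos j hj) (ha j hj)) (hxpos j hj)
  set φ : ℕ → ℂ → ℂ := fun j z => x j * Complex.exp ((1 - 2 * z) * l j) with hφ
  have hφd : ∀ j, Differentiable ℂ (φ j) := fun j => by fun_prop
  have hφn : ∀ j z, ‖φ j z‖ = ‖x j‖ * Real.exp ((1 - 2 * z.re) * l j) := fun j z =>
    norm_mul_exp _ _ _
  have hφ0 : ∀ j ∈ s, ∀ t : ℝ, ‖φ j (t * Complex.I)‖ = r * a j := by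
    intro j hj t
    rw [hφn]
    have h1 : (1 - 2 * (t * Complex.I : ℂ).re) * l j = l j := by simp
    rw [h1, hl, Real.exp_log (hquot j hj), mul_div_cancel₀ _ (hxpos j hj).ne']
  have hφ1 : ∀ j ∈ s, ∀ t : ℝ, ‖φ j (1 + t * Complex.I)‖ = r⁻¹ * (‖x j‖ ^ 2 / a j) := by
    intro j hj t
    rw [hφn]
    have h1 : (1 - 2 * (1 + t * Complex.I : ℂ).re) * l j = -l j := by
      simp
      ring
    have h2 := (hxpos j hj).ne'
    have h3 := (ha j hj).ne'
    have h4 := (hrpos j hj).ne'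
    rw [h1, hl, Real.exp_neg, Real.exp_log (hquot j hj)]
    field_simp
  have hK := unconditionalConst_nonneg b
  obtain ⟨F, hF, hFn⟩ : ∃ F : calderon b, F.1.1 = (fun z => ∑ j ∈ s, φ j z • inclX b (b j)) ∧
      calderonNorm F ≤ unconditionalConst b * r := by
    refine exists_calderon b (f0 := fun t : ℝ => ∑ j ∈ s, φ j (t * Complex.I) • b j)
      (f1 := fun t : ℝ => ∑ j ∈ s, φ j (1 + t * Complex.I) • b.coord j)
      (M := ∑ j ∈ s, ‖x j‖ * Real.exp |l j| * ‖inclX b (b j)‖) ?_ (fun z hz => ?_)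
      (fun t => ?_) (fun t => ?_) ?_ ?_ (fun t => ?_) (fun t => ?_)
    · refine Differentiable.diffContOnCl ?_
      exact Differentiable.fun_sum fun j _ => (hφd j).smul_const _
    · refine (norm_sum_le _ _).trans (Finset.sum_le_sum fun j _ => ?_)
      rw [norm_smul, hφn]
      refine mul_le_mul_of_nonneg_right (mul_le_mul_of_nonneg_left ?_ (norm_nonneg _))
        (norm_nonneg _)
      refine Real.exp_le_exp.2 ((le_abs_self _).trans ?_)
      rw [abs_mul]
      refine mul_le_of_le_one_left (abs_nonneg _) ?_
      have h1 : 0 ≤ z.re := hz.1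
      have h2 : z.re ≤ 1 := hz.2
      rw [abs_le]
      constructor <;> linarith
    · simp only [map_sum, map_smul]
    · simp only [map_sum, map_smul, inclX_basis_eq]
    · refine continuous_finsetSum _ fun j _ => ?_
      exact ((hφd j).continuous.comp (by fun_prop)).smul continuous_const
    · refine continuous_finsetSum _ fun j _ => ?_
      exact ((hφd j).continuous.comp (by fun_prop)).smul continuous_const
    · have h1 := norm_sum_smul_le b (subset_refl s) (R := r)
        (a := fun j => φ j (t * Complex.I)) (c := fun j => (a j : ℂ)) (fun j hj => by
          rw [hφ0 j hj, Complex.norm_real, Real.norm_of_nonneg (ha j hj).le]) hr0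
      exact h1.trans (mul_le_of_le_one_right (mul_nonneg hK hr0) ha1)
    -- The dual half of the factorization is applied to the moduli of the coordinates of `u`, whose
    -- sum has norm at most `K ‖u‖`. The total weight is `r²`, and one factor `r` cancels.
    · refine ContinuousLinearMap.opNorm_le_bound _ (mul_nonneg hK hr0) fun u => ?_
      rcases eq_or_ne u 0 with rfl | hu
      · simp
      have hM : 0 < unconditionalConst b * ‖u‖ :=
        mul_pos (zero_lt_one.trans_le (one_le_unconditionalConst b)) (norm_pos_iff.2 hu)
      have h1 := norm_sum_smul_le_of_coord b (s := s) (R := 1)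
        (a := fun j => (‖b.coord j u‖ : ℂ)) (x := u) (fun j _ => by simp) zero_le_one
      rw [mul_one] at h1
      have h2 := hdual (fun j => ‖b.coord j u‖) _ (fun j _ => norm_nonneg _) hM h1
      rw [hsum] at h2
      calc ‖(∑ j ∈ s, φ j (1 + t * Complex.I) • b.coord j) u‖
          = ‖∑ j ∈ s, φ j (1 + t * Complex.I) * b.coord j u‖ := by
            simp
        _ ≤ ∑ j ∈ s, r⁻¹ * (‖x j‖ ^ 2 / a j * ‖b.coord j u‖) := by
            refine (norm_sum_le _ _).trans (Finset.sum_le_sum fun j hj => ?_)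
            rw [norm_mul, hφ1 j hj, mul_assoc]
        _ = r⁻¹ * ∑ j ∈ s, ‖x j‖ ^ 2 / a j * ‖b.coord j u‖ := by rw [Finset.mul_sum]
        _ ≤ r⁻¹ * (r ^ 2 * (unconditionalConst b * ‖u‖)) :=
            mul_le_mul_of_nonneg_left h2 (inv_nonneg.2 hr0)
        _ = unconditionalConst b * r * ‖u‖ := by
            rcases eq_or_lt_of_le hr0 with h | h
            · simp [← h]
            · field_simp
  have hseq : ∀ z i, toSeq b (F.1.1 z) i = if i ∈ s then φ i z else 0 := by
    intro z i
    rw [hF]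
    simp [map_sum, toSeq_inclX_basis, Finset.sum_apply, unitSeq, Pi.single_apply]
  refine ⟨F, ?_, fun j hj => ?_, hFn⟩
  · ext i
    change toSeq b (F.1.1 (1 / 2)) i = x i
    rw [hseq]
    split_ifs with hi
    · simp [hφ]
    · exact (hxs i hi).symm
  · refine (hasDerivAt_toSeq b F j).unique ?_
    have hjs : j ∉ s := fun h =>
      (not_lt.2 hj) (Finset.mem_range.1 (Finset.mem_filter.1 h).1)
    simp only [hseq, if_neg hjs]
    exact hasDerivAt_const _ _

/-- One factor `K` comes from the pairing and one from lifting the test sequence. -/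
theorem l2Norm_evalHalf_le (n : ℕ) (F : calderon b) :
    l2Norm n (evalHalf b F) ≤ unconditionalConst b ^ 2 * calderonNorm F := by
  have hK := unconditionalConst_nonneg b
  refine l2Norm_le_of_forall (mul_nonneg (sq_nonneg _) (calderonNorm_nonneg F)) fun y hy => ?_
  obtain ⟨G, rfl, -, hG⟩ := exists_calderon_of_support b hy
  refine (pairing_bounds b n F G).1.trans ?_
  calc unconditionalConst b * (calderonNorm F * calderonNorm G)
      ≤ unconditionalConst b * (calderonNorm F *
          (unconditionalConst b * l2Norm n (evalHalf b G))) :=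
        mul_le_mul_of_nonneg_left (mul_le_mul_of_nonneg_left hG (calderonNorm_nonneg F)) hK
    _ = _ := by ring

theorem interpENorm_le_l2Norm {n : ℕ} {x : ℕ → ℂ} (hx : ∀ j, n ≤ j → x j = 0) :
    interpENorm b x ≤ ENNReal.ofReal (unconditionalConst b * l2Norm n x) := by
  obtain ⟨F, rfl, -, hF⟩ := exists_calderon_of_support b hx
  exact (interpENorm_evalHalf_le b F).trans (ENNReal.ofReal_le_ofReal hF)

theorem ofReal_l2Norm_le (n : ℕ) (x : ℕ → ℂ) :
    ENNReal.ofReal (l2Norm n x) ≤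
      ENNReal.ofReal (unconditionalConst b ^ 2) * interpENorm b x := by
  have hK : 0 < unconditionalConst b := zero_lt_one.trans_le (one_le_unconditionalConst b)
  rw [interpENorm]
  have h0 : ENNReal.ofReal (unconditionalConst b ^ 2) ≠ 0 := by
    rw [Ne, ENNReal.ofReal_eq_zero, not_le]
    positivity
  simp only [ENNReal.mul_iInf_of_ne h0 ENNReal.ofReal_ne_top]
  refine le_iInf₂ fun F hF => ?_
  rw [← ENNReal.ofReal_mul (sq_nonneg _), ← hF]
  exact ENNReal.ofReal_le_ofReal (l2Norm_evalHalf_le b n F)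

end Factorization

/-! ### Part (a): the space `Z(Xₙ)` and its duality map. -/

section Section

variable {X : Type*} [NormedAddCommGroup X] [NormedSpace ℂ X]
  {b : UnconditionalSchauderBasis ℕ ℂ X} {n : ℕ}

theorem ZFin.fst_add (p q : ZFin b n) : (p + q).fst = p.fst + q.fst := rfl
theorem ZFin.snd_add (p q : ZFin b n) : (p + q).snd = p.snd + q.snd := rfl
theorem ZFin.fst_smul (c : ℂ) (p : ZFin b n) : (c • p).fst = c • p.fst := rfl
theorem ZFin.snd_smul (c : ℂ) (p : ZFin b n) : (c • p).snd = c • p.snd := rfl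

variable (b) in
/-- The inclusion of `Z(X)` in the pairs of sequences, as a linear map. -/
def pairLinear : Z b →ₗ[ℂ] (ℕ → ℂ) × (ℕ → ℂ) where
  toFun := Z.pair
  map_add' _ _ := rfl
  map_smul' _ _ := rfl

theorem pair_v_of_even {i : ℕ} (h : i % 2 = 0) : (v b i).pair = (unitSeq (i / 2), 0) :=
  congrArg Z.pair (show v b i = _ from if_pos h)

theorem pair_v_of_odd {i : ℕ} (h : ¬ i % 2 = 0) : (v b i).pair = (0, unitSeq (i / 2)) :=
  congrArg Z.pair (show v b i = _ from if_neg h)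

theorem Zsection_le : Zsection b n ≤ (pairSection n).comap (pairLinear b) := by
  refine Submodule.span_le.2 ?_
  rintro _ ⟨i, hi, rfl⟩ j hj
  have h1 : i < 2 * n := hi
  have h2 : i / 2 ≠ j := by omega
  change (v b i).pair.1 j = 0 ∧ (v b i).pair.2 j = 0
  by_cases h : i % 2 = 0
  · rw [pair_v_of_even h]
    exact ⟨Pi.single_eq_of_ne' h2 _, rfl⟩
  · rw [pair_v_of_odd h]
    exact ⟨rfl, Pi.single_eq_of_ne' h2 _⟩

theorem ZFin.fst_eq_zero (p : ZFin b n) (j : ℕ) (hj : n ≤ j) : p.fst j = 0 :=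
  (Zsection_le p.2 j hj).1

theorem ZFin.snd_eq_zero (p : ZFin b n) (j : ℕ) (hj : n ≤ j) : p.snd j = 0 :=
  (Zsection_le p.2 j hj).2

theorem eq_sum_unitSeq {x : ℕ → ℂ} (hx : ∀ j, n ≤ j → x j = 0) :
    x = ∑ j ∈ Finset.range n, x j • unitSeq j := by
  ext i
  rw [Finset.sum_apply]
  simp only [Pi.smul_apply, unitSeq, Pi.single_apply, smul_eq_mul, mul_ite, mul_one, mul_zero]
  rw [Finset.sum_ite_eq]
  split_ifs with h
  · rfl
  · exact hx i (not_lt.1 fun h' => h (Finset.mem_range.2 h'))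

theorem v_two_mul (j : ℕ) : (v b (2 * j)).pair = (unitSeq j, 0) := by
  rw [pair_v_of_even (by omega), show 2 * j / 2 = j by omega]

theorem v_two_mul_add_one (j : ℕ) : (v b (2 * j + 1)).pair = (0, unitSeq j) := by
  rw [pair_v_of_odd (by omega), show (2 * j + 1) / 2 = j by omega]

variable (b) in
/-- Every pair of sequences supported on the first `n` coordinates belongs to `Z(Xₙ)`. -/
theorem ZFin.exists_pair {x y : ℕ → ℂ} (hx : ∀ j, n ≤ j → x j = 0) (hy : ∀ j, n ≤ j → y j = 0) :
    ∃ p : ZFin b n, p.fst = x ∧ p.snd = y := by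
  set q : Z b := ∑ j ∈ Finset.range n, (x j • v b (2 * j) + y j • v b (2 * j + 1)) with hq
  have hmem : q ∈ Zsection b n := by
    refine Submodule.sum_mem _ fun j hj => ?_
    have hj' := Finset.mem_range.1 hj
    refine Submodule.add_mem _ (Submodule.smul_mem _ _ ?_) (Submodule.smul_mem _ _ ?_)
    · exact Submodule.subset_span ⟨2 * j, by simp only [Set.mem_Iio]; omega, rfl⟩
    · exact Submodule.subset_span ⟨2 * j + 1, by simp only [Set.mem_Iio]; omega, rfl⟩
  have hpair : q.pair = (x, y) := by
    change pairLinear b q = _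
    have hv0 : ∀ j, pairLinear b (v b (2 * j)) = (unitSeq j, 0) := v_two_mul
    have hv1 : ∀ j, pairLinear b (v b (2 * j + 1)) = (0, unitSeq j) := v_two_mul_add_one
    simp only [hq, map_sum, map_add, map_smul, hv0, hv1]
    refine Prod.ext ?_ ?_
    · rw [Prod.fst_sum]
      simpa using (eq_sum_unitSeq hx).symm
    · rw [Prod.snd_sum]
      simpa using (eq_sum_unitSeq hy).symm
  exact ⟨⟨q, hmem⟩, congrArg Prod.fst hpair, congrArg Prod.snd hpair⟩

theorem ZFin.norm_def (p : ZFin b n) : ‖p‖ = (derivedENorm b (p.fst, p.snd)).toReal := rfl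

theorem ZFin.norm_le {p : ZFin b n} {F : calderon b} (h1 : evalHalf b F = p.fst)
    (h2 : derivHalf b F = p.snd) : ‖p‖ ≤ calderonNorm F := by
  rw [ZFin.norm_def, ← h1, ← h2]
  exact ENNReal.toReal_le_of_le_ofReal (calderonNorm_nonneg F) (derivedENorm_le b F)

theorem ZFin.exists_calderon_lt {p : ZFin b n} {r : ℝ} (h : ‖p‖ < r) :
    ∃ F : calderon b, evalHalf b F = p.fst ∧ derivHalf b F = p.snd ∧ calderonNorm F < r := by
  have htop : derivedENorm b (p.fst, p.snd) ≠ ∞ := (p.1.2 : derivedENorm b _ < ∞).ne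
  have hr : 0 < r := (norm_nonneg p).trans_lt h
  rw [ZFin.norm_def, ← ENNReal.lt_ofReal_iff_toReal_lt htop] at h
  obtain ⟨F, ⟨h1, h2⟩, hF⟩ := (derivedENorm_lt_iff b _ _).1 h
  exact ⟨F, h1, h2, (ENNReal.ofReal_lt_ofReal_iff hr).1 hF⟩

instance : FiniteDimensional ℂ (ZFin b n) :=
  FiniteDimensional.span_of_finite ℂ ((Set.finite_Iio (2 * n)).image (v b))

variable [CompleteSpace X]

/-- The sum is the derivative at `1/2` of the pairing of representatives `F`, `G`. These are only
nearly optimal, whence the limit in `ε`. -/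
theorem ZFin.norm_pairing_le (p q : ZFin b n) :
    ‖∑ j ∈ Finset.range n, (p.snd j * q.fst j - p.fst j * q.snd j)‖ ≤
      4 * unconditionalConst b * ‖p‖ * ‖q‖ := by
  have hlim : Tendsto (fun ε : ℝ => 4 * (unconditionalConst b * ((‖p‖ + ε) * (‖q‖ + ε))))
      (𝓝[>] 0) (𝓝 (4 * (unconditionalConst b * ((‖p‖ + 0) * (‖q‖ + 0))))) :=
    tendsto_nhdsWithin_of_tendsto_nhds (Continuous.tendsto (by fun_prop) 0)
  refine (ge_of_tendsto (b := ‖∑ j ∈ Finset.range n, (p.snd j * q.fst j - p.fst j * q.snd j)‖)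
    hlim ?_).trans (le_of_eq (by ring))
  filter_upwards [self_mem_nhdsWithin] with ε hε
  have hε' : 0 < ε := hε
  obtain ⟨F, hF1, hF2, hF⟩ := ZFin.exists_calderon_lt (lt_add_of_pos_right ‖p‖ hε')
  obtain ⟨G, hG1, hG2, hG⟩ := ZFin.exists_calderon_lt (lt_add_of_pos_right ‖q‖ hε')
  have h := (pairing_bounds b n F G).2
  rw [hF1, hF2, hG1, hG2] at h
  refine h.trans (mul_le_mul_of_nonneg_left (mul_le_mul_of_nonneg_left ?_
    (unconditionalConst_nonneg b)) (by norm_num))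
  exact mul_le_mul hF.le hG.le (calderonNorm_nonneg G) ((calderonNorm_nonneg F).trans hF.le)

variable (b n) in
/-- The natural duality map of `Z(Xₙ)`. -/
noncomputable def derivedDuality : ZFin b n →L[ℂ] StrongDual ℂ (ZFin b n) :=
  LinearMap.mkContinuous₂
    (LinearMap.mk₂ ℂ (fun p q : ZFin b n =>
        ∑ j ∈ Finset.range n, (p.snd j * q.fst j - p.fst j * q.snd j))
      (fun p p' q => by
        rw [← Finset.sum_add_distrib]
        refine Finset.sum_congr rfl fun j _ => ?_
        simp only [ZFin.fst_add, ZFin.snd_add, Pi.add_apply]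
        ring)
      (fun c p q => by
        rw [Finset.smul_sum]
        refine Finset.sum_congr rfl fun j _ => ?_
        simp only [ZFin.fst_smul, ZFin.snd_smul, Pi.smul_apply, smul_eq_mul]
        ring)
      (fun p q q' => by
        rw [← Finset.sum_add_distrib]
        refine Finset.sum_congr rfl fun j _ => ?_
        simp only [ZFin.fst_add, ZFin.snd_add, Pi.add_apply]
        ring)
      (fun c p q => by
        rw [Finset.smul_sum]
        refine Finset.sum_congr rfl fun j _ => ?_
        simp only [ZFin.fst_smul, ZFin.snd_smul, Pi.smul_apply, smul_eq_mul]
        ring))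
    (4 * unconditionalConst b) ZFin.norm_pairing_le

theorem derivedDuality_apply (p q : ZFin b n) : derivedDuality b n p q =
    ∑ j ∈ Finset.range n, (p.snd j * q.fst j - p.fst j * q.snd j) := rfl

theorem norm_derivedDuality_le : ‖derivedDuality b n‖ ≤ 4 * unconditionalConst b :=
  LinearMap.mkContinuous₂_norm_le _
    (mul_nonneg (by norm_num) (unconditionalConst_nonneg b)) _

/-- If `F` lifts the first sequence of `p`, then `p = (F(1/2), F'(1/2)) + (0, p.snd - F'(1/2))`.
Each summand is controlled by testing the functional on suitable vectors. -/
theorem norm_le_norm_derivedDuality (p : ZFin b n) :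
    ‖p‖ ≤ (6 * unconditionalConst b ^ 2 + 36 * unconditionalConst b ^ 5) *
      ‖derivedDuality b n p‖ := by
  set K := unconditionalConst b with hKdef
  have hK : 0 ≤ K := unconditionalConst_nonneg b
  set N := ‖derivedDuality b n p‖ with hN
  have hN0 : 0 ≤ N := norm_nonneg _
  -- The test vectors are `(0, y)`, of norm at most `3K` times the Euclidean norm of `y`.
  have hfst : l2Norm n p.fst ≤ 3 * K * N := by
    refine l2Norm_le_of_forall (by positivity) fun y hy => ?_
    obtain ⟨G₀, rfl, -, hG₀⟩ := exists_calderon_of_support b hy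
    obtain ⟨G, hG1, hG2, hG⟩ := exists_calderon_deriv_eq b G₀
    obtain ⟨q, hq1, hq2⟩ := ZFin.exists_pair b (n := n) (x := 0) (fun _ _ => rfl) hy
    have h1 := (derivedDuality b n p).le_opNorm q
    have h2 : derivedDuality b n p q = -∑ j ∈ Finset.range n, p.fst j * evalHalf b G₀ j := by
      rw [derivedDuality_apply, hq1, hq2, ← Finset.sum_neg_distrib]
      exact Finset.sum_congr rfl fun j _ => by simp
    rw [h2, norm_neg] at h1
    refine h1.trans ?_
    have h3 : ‖q‖ ≤ 3 * (K * l2Norm n (evalHalf b G₀)) :=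
      (ZFin.norm_le (hG1.trans hq1.symm) (hG2.trans hq2.symm)).trans
        (hG.trans (mul_le_mul_of_nonneg_left hG₀ (by norm_num)))
    calc N * ‖q‖ ≤ N * (3 * (K * l2Norm n (evalHalf b G₀))) :=
          mul_le_mul_of_nonneg_left h3 hN0
      _ = _ := by ring
  obtain ⟨F, hF1, hF2, hF⟩ := exists_calderon_of_support b p.fst_eq_zero
  replace hF : calderonNorm F ≤ 3 * K ^ 2 * N :=
    hF.trans ((mul_le_mul_of_nonneg_left hfst hK).trans (le_of_eq (by ring)))
  have hsupp : ∀ j, n ≤ j → (p.snd - derivHalf b F) j = 0 := fun j hj => by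
    rw [Pi.sub_apply, p.snd_eq_zero j hj, hF2 j hj, sub_zero]
  -- The test vectors are `(u, G'(1/2))` with `G` the lift of `u`. The functional then differs from
  -- `⟨p.snd - F'(1/2), u⟩` by the derivative of the pairing of `F` and `G`, which costs `4K · 3K² ·
  -- K = 12K⁴`.
  have hsnd : l2Norm n (p.snd - derivHalf b F) ≤ (K + 12 * K ^ 4) * N := by
    refine l2Norm_le_of_forall (by positivity) fun u hu => ?_
    obtain ⟨G, rfl, hG2, hG⟩ := exists_calderon_of_support b hu
    obtain ⟨q, hq1, hq2⟩ := ZFin.exists_pair b hu hG2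
    have h1 : ‖derivedDuality b n p q‖ ≤ N * (K * l2Norm n (evalHalf b G)) :=
      (derivedDuality b n p).le_opNorm_of_le ((ZFin.norm_le hq1.symm hq2.symm).trans hG)
    have h2 := (pairing_bounds b n F G).2
    have h3 : ∑ j ∈ Finset.range n, (p.snd - derivHalf b F) j * evalHalf b G j =
        derivedDuality b n p q - ∑ j ∈ Finset.range n,
          (derivHalf b F j * evalHalf b G j - evalHalf b F j * derivHalf b G j) := by
      rw [derivedDuality_apply, hq1, hq2, hF1, ← Finset.sum_sub_distrib]
      refine Finset.sum_congr rfl fun j _ => ?_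
      rw [Pi.sub_apply]
      ring
    rw [h3]
    refine (norm_sub_le _ _).trans ((add_le_add h1 h2).trans ?_)
    have h4 : calderonNorm F * calderonNorm G ≤
        3 * K ^ 2 * N * (K * l2Norm n (evalHalf b G)) :=
      mul_le_mul hF hG (calderonNorm_nonneg G) (by positivity)
    calc N * (K * l2Norm n (evalHalf b G)) + 4 * (K * (calderonNorm F * calderonNorm G))
        ≤ N * (K * l2Norm n (evalHalf b G)) +
          4 * (K * (3 * K ^ 2 * N * (K * l2Norm n (evalHalf b G)))) :=
          add_le_add le_rfl (mul_le_mul_of_nonneg_left (mul_le_mul_of_nonneg_left h4 hK)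
            (by norm_num))
      _ = _ := by ring
  -- The remainder is put in the derivative slot by a function vanishing at `1/2`; the final
  -- constant is `3K² + 3K(K + 12K⁴)`.
  obtain ⟨G₀, hG01, -, hG₀⟩ := exists_calderon_of_support b hsupp
  obtain ⟨G, hG1, hG2, hG⟩ := exists_calderon_deriv_eq b G₀
  have h1 : evalHalf b (F + G) = p.fst := by rw [map_add, hF1, hG1, add_zero]
  have h2 : derivHalf b (F + G) = p.snd := by rw [map_add, hG2, hG01, add_sub_cancel]
  refine (ZFin.norm_le h1 h2).trans ((calderonNorm_add_le F G).trans ?_)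
  have h3 := mul_le_mul_of_nonneg_left hsnd hK
  calc calderonNorm F + calderonNorm G ≤ 3 * K ^ 2 * N + 3 * (K * ((K + 12 * K ^ 4) * N)) :=
        add_le_add hF (hG.trans (mul_le_mul_of_nonneg_left (hG₀.trans h3) (by norm_num)))
    _ = _ := by ring

theorem derivedDuality_injective : Function.Injective (derivedDuality b n) := by
  refine (injective_iff_map_eq_zero _).2 fun p hp => ?_
  have h := norm_le_norm_derivedDuality p
  rw [hp, norm_zero, mul_zero] at h
  exact norm_le_zero_iff.1 h

variable (b n) in
/-- `Z(Xₙ)` is isomorphic to its dual, with constants that depend only on the unconditional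
constant. -/
theorem exists_derivedDuality_equiv : ∃ T : ZFin b n ≃L[ℂ] StrongDual ℂ (ZFin b n),
    (∀ p q : ZFin b n,
      T p q = ∑ j ∈ Finset.range n, (p.snd j * q.fst j - p.fst j * q.snd j)) ∧
    ‖(T : ZFin b n →L[ℂ] StrongDual ℂ (ZFin b n))‖ *
      ‖(T.symm : StrongDual ℂ (ZFin b n) →L[ℂ] ZFin b n)‖ ≤
        4 * unconditionalConst b *
          (6 * unconditionalConst b ^ 2 + 36 * unconditionalConst b ^ 5) := by
  have hK : 0 ≤ unconditionalConst b := unconditionalConst_nonneg b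
  -- The lower estimate gives injectivity; equal finite dimensions then give surjectivity.
  have hfin : Module.finrank ℂ (ZFin b n) = Module.finrank ℂ (StrongDual ℂ (ZFin b n)) := by
    rw [← (LinearMap.toContinuousLinearMap (𝕜 := ℂ) (E := ZFin b n) (F' := ℂ)).finrank_eq]
    exact Subspace.dual_finrank_eq.symm
  let T : ZFin b n ≃L[ℂ] StrongDual ℂ (ZFin b n) :=
    (LinearMap.linearEquivOfInjective (derivedDuality b n).toLinearMap
      derivedDuality_injective hfin).toContinuousLinearEquiv
  have hT : (T : ZFin b n →L[ℂ] StrongDual ℂ (ZFin b n)) = derivedDuality b n := by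
    ext p q
    rfl
  refine ⟨T, fun p q => ?_, ?_⟩
  · change (T : ZFin b n →L[ℂ] StrongDual ℂ (ZFin b n)) p q = _
    rw [hT, derivedDuality_apply]
  · refine mul_le_mul (by rw [hT]; exact norm_derivedDuality_le) ?_
      (ContinuousLinearMap.opNorm_nonneg _) (by positivity)
    refine ContinuousLinearMap.opNorm_le_bound _ (by positivity) fun φ => ?_
    have h := norm_le_norm_derivedDuality (T.symm φ)
    have h2 : derivedDuality b n (T.symm φ) = φ := by
      rw [← hT]
      exact T.apply_symm_apply φ
    rw [h2] at h
    exact h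

end Section

/-! ### The norm of the interpolation space and the estimate `Δ(Ω) ≤ 4Kρ`. -/

section Interpolation

variable {X : Type*} [NormedAddCommGroup X] [NormedSpace ℂ X]
  {b : UnconditionalSchauderBasis ℕ ℂ X} {n : ℕ}

theorem exists_ofReal_eq {c : ℝ≥0∞} (h : c < ∞) : ∃ r : ℝ, 0 ≤ r ∧ c = ENNReal.ofReal r :=
  ⟨c.toReal, ENNReal.toReal_nonneg, (ENNReal.ofReal_toReal h.ne).symm⟩

theorem exists_calderon_of_interpENorm_le {x : ℕ → ℂ} {r : ℝ} (hr : 0 ≤ r)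
    (hx : interpENorm b x ≤ ENNReal.ofReal r) {ε : ℝ} (hε : 0 < ε) :
    ∃ F : calderon b, evalHalf b F = x ∧ calderonNorm F < r + ε := by
  have h : interpENorm b x < ENNReal.ofReal (r + ε) :=
    hx.trans_lt ((ENNReal.ofReal_lt_ofReal_iff (by linarith)).2 (by linarith))
  obtain ⟨F, h1, h2⟩ := (interpENorm_lt_iff b _ _).1 h
  exact ⟨F, h1, (ENNReal.ofReal_lt_ofReal_iff (by linarith)).1 h2⟩

/-- A bound for the norm of the interpolation space follows from the bounds for all functions of
the Calderón space. -/
theorem interpENorm_le_of_forall {x y : ℕ → ℂ} {r R : ℝ} (hr : 0 ≤ r)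
    (hx : interpENorm b x ≤ ENNReal.ofReal r)
    (h : ∀ F : calderon b, evalHalf b F = x →
      interpENorm b y ≤ ENNReal.ofReal (R * calderonNorm F)) (hR : 0 ≤ R) :
    interpENorm b y ≤ ENNReal.ofReal (R * r) := by
  have hlim : Tendsto (fun ε : ℝ => ENNReal.ofReal (R * (r + ε))) (𝓝[>] 0)
      (𝓝 (ENNReal.ofReal (R * (r + 0)))) :=
    tendsto_nhdsWithin_of_tendsto_nhds
      (Continuous.tendsto (ENNReal.continuous_ofReal.comp (by fun_prop)) 0)
  rw [add_zero] at hlim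
  refine ge_of_tendsto hlim ?_
  filter_upwards [self_mem_nhdsWithin] with ε hε
  obtain ⟨F, hF, hFr⟩ := exists_calderon_of_interpENorm_le hr hx hε
  exact (h F hF).trans (ENNReal.ofReal_le_ofReal (mul_le_mul_of_nonneg_left hFr.le hR))

theorem interpENorm_smul_le {x : ℕ → ℂ} {r : ℝ} (c : ℂ) (hr : 0 ≤ r)
    (hx : interpENorm b x ≤ ENNReal.ofReal r) :
    interpENorm b (c • x) ≤ ENNReal.ofReal (‖c‖ * r) := by
  refine interpENorm_le_of_forall hr hx (fun F hF => ?_) (norm_nonneg c)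
  rw [← hF, ← map_smul]
  exact (interpENorm_evalHalf_le b _).trans (ENNReal.ofReal_le_ofReal (calderonNorm_smul_le c F))

theorem interpENorm_neg_le {x : ℕ → ℂ} {r : ℝ} (hr : 0 ≤ r)
    (hx : interpENorm b x ≤ ENNReal.ofReal r) : interpENorm b (-x) ≤ ENNReal.ofReal r := by
  simpa using interpENorm_smul_le (-1) hr hx

theorem interpENorm_add_le {x y : ℕ → ℂ} {r s : ℝ} (hr : 0 ≤ r) (hs : 0 ≤ s)
    (hx : interpENorm b x ≤ ENNReal.ofReal r) (hy : interpENorm b y ≤ ENNReal.ofReal s) :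
    interpENorm b (x + y) ≤ ENNReal.ofReal (r + s) := by
  have hlim : Tendsto (fun ε : ℝ => ENNReal.ofReal ((r + ε) + (s + ε))) (𝓝[>] 0)
      (𝓝 (ENNReal.ofReal ((r + 0) + (s + 0)))) :=
    tendsto_nhdsWithin_of_tendsto_nhds
      (Continuous.tendsto (ENNReal.continuous_ofReal.comp (by fun_prop)) 0)
  rw [add_zero, add_zero] at hlim
  refine ge_of_tendsto hlim ?_
  filter_upwards [self_mem_nhdsWithin] with ε hε
  obtain ⟨F, rfl, hF⟩ := exists_calderon_of_interpENorm_le hr hx hε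
  obtain ⟨G, rfl, hG⟩ := exists_calderon_of_interpENorm_le hs hy hε
  rw [← map_add]
  exact (interpENorm_evalHalf_le b _).trans (ENNReal.ofReal_le_ofReal
    ((calderonNorm_add_le F G).trans (add_le_add hF.le hG.le)))

theorem interpENorm_zero : interpENorm b 0 = 0 := by
  have h := interpENorm_evalHalf_le b 0
  have h0 : calderonNorm (0 : calderon b) ≤ 0 := by
    simpa using calderonNorm_smul_le (0 : ℂ) (0 : calderon b)
  rw [map_zero, ENNReal.ofReal_of_nonpos h0] at h
  exact le_antisymm h zero_le

theorem calderonNorm_add_neg_le (F G : calderon b) : calderonNorm (F + (-1 : ℂ) • G) ≤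
    calderonNorm F + calderonNorm G := by
  have h := calderonNorm_smul_le (-1 : ℂ) G
  rw [norm_neg, norm_one, one_mul] at h
  exact (calderonNorm_add_le F _).trans (add_le_add le_rfl h)

theorem IsBoundedSelection.calderonNorm_le {ρ : ℝ} {B : (ℕ → ℂ) → calderon b}
    (hB : IsBoundedSelection b ρ B) (hρ : 0 ≤ ρ) {x : ℕ → ℂ} {r : ℝ} (hr : 0 ≤ r)
    (hx : interpENorm b x ≤ ENNReal.ofReal r) : calderonNorm (B x) ≤ ρ * r := by
  have h := (hB.norm_le x (hx.trans_lt ENNReal.ofReal_lt_top)).trans (mul_le_mul_right hx _)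
  rw [← ENNReal.ofReal_mul hρ] at h
  exact (ENNReal.ofReal_le_ofReal_iff (mul_nonneg hρ hr)).1 h

theorem IsBoundedSelection.selectionMap_smul {ρ : ℝ} {B : (ℕ → ℂ) → calderon b}
    (hB : IsBoundedSelection b ρ B) (c : ℂ) {x : ℕ → ℂ} (hx : interpENorm b x < ∞) :
    selectionMap B (c • x) = c • selectionMap B x := by
  change toSeq b (deriv (B (c • x)).1.1 (1 / 2)) = c • toSeq b (deriv (B x).1.1 (1 / 2))
  -- Homogeneity is only assumed on the closed strip, which is a neighbourhood of `1/2`.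
  have h : (B (c • x)).1.1 =ᶠ[𝓝 (1 / 2)] fun z => c • (B x).1.1 z := by
    filter_upwards [isOpen_strip.mem_nhds half_mem_strip] with z hz
    exact hB.homogeneous c x hx z (strip_subset_closedStrip hz)
  rw [h.deriv_eq, deriv_fun_const_smul c (differentiableAt_half (B x)), map_smul]

variable [CompleteSpace X]

theorem interpENorm_diag_le (a : lp (fun _ : ℕ => ℂ) ∞) {x : ℕ → ℂ} {r : ℝ} (hr : 0 ≤ r)
    (hx : interpENorm b x ≤ ENNReal.ofReal r) :
    interpENorm b (⇑a * x) ≤ ENNReal.ofReal (unconditionalConst b * ‖a‖ * r) := by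
  refine interpENorm_le_of_forall hr hx (fun F hF => ?_)
    (mul_nonneg (unconditionalConst_nonneg b) (norm_nonneg a))
  obtain ⟨G, hG, -, hGn⟩ := exists_calderon_diag b a F
  rw [← hF, ← hG]
  exact (interpENorm_evalHalf_le b G).trans (ENNReal.ofReal_le_ofReal hGn)

theorem l2Norm_le_of_interpENorm_le {x : ℕ → ℂ} {r : ℝ} (hr : 0 ≤ r)
    (hx : interpENorm b x ≤ ENNReal.ofReal r) : l2Norm n x ≤ unconditionalConst b ^ 2 * r := by
  have h := (ofReal_l2Norm_le b n x).trans (mul_le_mul_right hx _)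
  rw [← ENNReal.ofReal_mul (sq_nonneg _)] at h
  exact (ENNReal.ofReal_le_ofReal_iff (mul_nonneg (sq_nonneg _) hr)).1 h

/-- The centralizer estimate for the map associated with a bounded selection. -/
theorem IsBoundedSelection.centralizerConst_le {ρ : ℝ} {B : (ℕ → ℂ) → calderon b}
    (hB : IsBoundedSelection b ρ B) (hρ : 0 ≤ ρ) :
    centralizerConst b (selectionMap B) ≤ ENNReal.ofReal (4 * unconditionalConst b * ρ) := by
  refine sInf_le fun a x hx => ?_
  have hK := unconditionalConst_nonneg b
  obtain ⟨r, hr, hxr⟩ := exists_ofReal_eq hx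
  have hax := interpENorm_diag_le a hr hxr.le
  have hKar : 0 ≤ unconditionalConst b * ‖a‖ * r := by positivity
  obtain ⟨G, hG1, hG2, hG⟩ := exists_calderon_diag b a (B x)
  have h0 : evalHalf b (B (⇑a * x) + (-1 : ℂ) • G) = 0 := by
    rw [map_add, map_smul, hB.eval_eq _ (hax.trans_lt ENNReal.ofReal_lt_top), hG1,
      hB.eval_eq x hx, neg_one_smul, add_neg_cancel]
  -- `B (a x) - a B x` vanishes at `1/2` and has norm at most `2Kρ ‖a‖ r`; the division by `z - 1/2`
  -- doubles this.
  obtain ⟨H, hH1, hH⟩ := exists_calderon_eval_eq b (B (⇑a * x) + (-1 : ℂ) • G)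
    (toSeq_injective b (h0.trans (map_zero _).symm))
  have h1 : evalHalf b H = selectionMap B (⇑a * x) - ⇑a * selectionMap B x := by
    rw [hH1, map_add, map_smul, hG2, neg_one_smul, ← sub_eq_add_neg]
    rfl
  rw [← h1, hxr, ← ENNReal.ofReal_mul (by positivity), ← ENNReal.ofReal_mul (by positivity)]
  refine (interpENorm_evalHalf_le b H).trans (ENNReal.ofReal_le_ofReal (hH.trans ?_))
  have h2 := calderonNorm_add_neg_le (B (⇑a * x)) G
  have h3 := hB.calderonNorm_le hρ hKar hax
  have h4 := hG.trans (mul_le_mul_of_nonneg_left (hB.calderonNorm_le hρ hr hxr.le)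
    (mul_nonneg hK (norm_nonneg a)))
  calc 2 * calderonNorm (B (⇑a * x) + (-1 : ℂ) • G)
      ≤ 2 * (ρ * (unconditionalConst b * ‖a‖ * r) + unconditionalConst b * ‖a‖ * (ρ * r)) := by
        linarith
    _ = _ := by ring

end Interpolation

/-! ### Part (b): estimates for homogeneous centralizers and twisted sums. -/

section Centralizer

variable {X : Type*} [NormedAddCommGroup X] [NormedSpace ℂ X]

/-- `Ω` is a homogeneous centralizer of the interpolation space with constant at most `D`. -/
structure IsCentralizer (b : UnconditionalSchauderBasis ℕ ℂ X) (D : ℝ)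
    (Ω : (ℕ → ℂ) → (ℕ → ℂ)) : Prop where
  nonneg : 0 ≤ D
  smul : ∀ (c : ℂ) {x : ℕ → ℂ}, interpENorm b x < ∞ → Ω (c • x) = c • Ω x
  le : ∀ (a : lp (fun _ : ℕ => ℂ) ∞) {x : ℕ → ℂ} {r : ℝ}, 0 ≤ r →
    interpENorm b x ≤ ENNReal.ofReal r →
      interpENorm b (Ω (⇑a * x) - ⇑a * Ω x) ≤ ENNReal.ofReal (D * ‖a‖ * r)

theorem exists_lp_eq {a : ℕ → ℂ} {C : ℝ} (hC : 0 ≤ C) (h : ∀ j, ‖a j‖ ≤ C) :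
    ∃ A : lp (fun _ : ℕ => ℂ) ∞, ⇑A = a ∧ ‖A‖ ≤ C := by
  have hm : Memℓp a ∞ := memℓp_infty ⟨C, by rintro _ ⟨j, rfl⟩; exact h j⟩
  exact ⟨⟨a, hm⟩, rfl, lp.norm_le_of_forall_le hC h⟩

/-- The restriction of a sequence to its first `n` terms. -/
def truncate (n : ℕ) (x : ℕ → ℂ) : ℕ → ℂ := fun j => if j < n then x j else 0

theorem truncate_of_le {n j : ℕ} (hj : n ≤ j) (x : ℕ → ℂ) : truncate n x j = 0 :=
  if_neg (not_lt.2 hj)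

theorem truncate_of_lt {n j : ℕ} (hj : j < n) (x : ℕ → ℂ) : truncate n x j = x j := if_pos hj

variable {b : UnconditionalSchauderBasis ℕ ℂ X} {n : ℕ} {D : ℝ} {Ω : (ℕ → ℂ) → (ℕ → ℂ)}

theorem IsCentralizer.map_zero (hΩ : IsCentralizer b D Ω) : Ω 0 = 0 := by
  have h := hΩ.smul (0 : ℂ) (x := 0) (by rw [interpENorm_zero]; exact ENNReal.zero_lt_top)
  rwa [zero_smul, zero_smul] at h

theorem twistedENorm_neg (p : (ℕ → ℂ) × (ℕ → ℂ)) :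
    twistedENorm b (-Ω) p = interpENorm b (p.1 + Ω p.2) + interpENorm b p.2 := by
  rw [twistedENorm, Pi.neg_apply, sub_neg_eq_add]

/-- Rescaling to the unit ball is legitimate because `Ω` is homogeneous; the slack `ε` keeps the
divisor positive when `r + s = 0`. -/
theorem IsCentralizer.norm_apply_le (hΩ : IsCentralizer b D Ω) {φ : Module.Dual ℂ (pairSection n)}
    {N : ℝ} (hN : 0 ≤ N) (hφ : twistedDualENorm b (-Ω) n φ ≤ ENNReal.ofReal N)
    {q : pairSection n} {r s : ℝ} (hr : 0 ≤ r) (hs : 0 ≤ s)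
    (h1 : interpENorm b (q.1.1 + Ω q.1.2) ≤ ENNReal.ofReal r)
    (h2 : interpENorm b q.1.2 ≤ ENNReal.ofReal s) : ‖φ q‖ ≤ N * (r + s) := by
  have hlim : Tendsto (fun ε : ℝ => N * (r + s + ε)) (𝓝[>] 0) (𝓝 (N * (r + s + 0))) :=
    tendsto_nhdsWithin_of_tendsto_nhds (Continuous.tendsto (by fun_prop) 0)
  rw [add_zero] at hlim
  refine ge_of_tendsto hlim ?_
  filter_upwards [self_mem_nhdsWithin] with ε hε
  have hε' : 0 < ε := hε
  set R := r + s + ε with hR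
  have hR0 : 0 < R := by positivity
  set c : ℂ := ((R⁻¹ : ℝ) : ℂ) with hc
  have hcn : ‖c‖ = R⁻¹ := by
    rw [hc, Complex.norm_real, Real.norm_of_nonneg (inv_nonneg.2 hR0.le)]
  have hq : twistedENorm b (-Ω) (c • q : pairSection n) ≤ 1 := by
    have e1 := interpENorm_smul_le c hr h1
    have e2 := interpENorm_smul_le c hs h2
    rw [smul_add, ← hΩ.smul c (h2.trans_lt ENNReal.ofReal_lt_top)] at e1
    rw [twistedENorm_neg]
    refine (add_le_add e1 e2).trans ?_
    rw [← ENNReal.ofReal_add (by positivity) (by positivity), ENNReal.ofReal_le_one, ← mul_add,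
      hcn, inv_mul_le_iff₀ hR0]
    linarith
  have h3 : ENNReal.ofReal ‖φ (c • q)‖ ≤ ENNReal.ofReal N :=
    (le_iSup₂ (f := fun (q : pairSection n) (_ : twistedENorm b (-Ω) q ≤ 1) =>
      ENNReal.ofReal ‖φ q‖) (c • q) hq).trans hφ
  rw [ENNReal.ofReal_le_ofReal_iff hN, map_smul, norm_smul, hcn, inv_mul_le_iff₀ hR0, mul_comm] at h3
  exact h3

variable [CompleteSpace X]

/-- The bound `4Kρ` is used only for finiteness. The added 1 leaves room for an admissible constant,
so it need not be known that the infimum is attained. -/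
theorem IsBoundedSelection.isCentralizer {ρ : ℝ} {B : (ℕ → ℂ) → calderon b}
    (hB : IsBoundedSelection b ρ B) (hρ : 0 ≤ ρ) :
    IsCentralizer b ((centralizerConst b (selectionMap B)).toReal + 1) (selectionMap B) := by
  have hfin : centralizerConst b (selectionMap B) < ∞ :=
    (hB.centralizerConst_le hρ).trans_lt ENNReal.ofReal_lt_top
  set Δ := (centralizerConst b (selectionMap B)).toReal with hΔ
  have hΔ0 : 0 ≤ Δ := ENNReal.toReal_nonneg
  have hlt : centralizerConst b (selectionMap B) < ENNReal.ofReal (Δ + 1) :=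
    (ENNReal.lt_ofReal_iff_toReal_lt hfin.ne).2 (lt_add_one Δ)
  obtain ⟨C, hC, hCΔ⟩ := sInf_lt_iff.1 hlt
  refine ⟨by positivity, fun c x hx => hB.selectionMap_smul c hx, fun a x r hr hx => ?_⟩
  refine (hC a x (hx.trans_lt ENNReal.ofReal_lt_top)).trans ?_
  rw [ENNReal.ofReal_mul (by positivity), ENNReal.ofReal_mul (by positivity)]
  gcongr

/-- A centralizer is almost symmetric for the bilinear pairing. -/
theorem IsCentralizer.norm_commutator_le (hΩ : IsCentralizer b D Ω) {y v : ℕ → ℂ}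
    (hy : ∀ j, n ≤ j → y j = 0) (hv : ∀ j, n ≤ j → v j = 0) :
    ‖∑ j ∈ Finset.range n, (Ω y j * v j - y j * Ω v j)‖ ≤
      4 * unconditionalConst b ^ 3 * D * l2Norm n y * l2Norm n v := by
  have hK := unconditionalConst_nonneg b
  have hD := hΩ.nonneg
  rcases eq_or_lt_of_le (l2Norm_nonneg n y) with hp | hp
  · rw [eq_zero_of_l2Norm_eq_zero hy hp.symm, hΩ.map_zero, ← eq_zero_of_l2Norm_eq_zero hy hp.symm,
      ← hp]
    simp [eq_zero_of_l2Norm_eq_zero hy hp.symm]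
  rcases eq_or_lt_of_le (l2Norm_nonneg n v) with hq | hq
  · rw [eq_zero_of_l2Norm_eq_zero hv hq.symm, hΩ.map_zero, ← eq_zero_of_l2Norm_eq_zero hv hq.symm,
      ← hq]
    simp [eq_zero_of_l2Norm_eq_zero hv hq.symm]
  set p := l2Norm n y with hpdef
  set q := l2Norm n v with hqdef
  -- A common majorant: `|y| ≤ p s` and `|v| ≤ q s`, with Euclidean norm at most 2.
  set s : ℕ → ℂ := (fun j => ((p⁻¹ * ‖y j‖ : ℝ) : ℂ)) + fun j => ((q⁻¹ * ‖v j‖ : ℝ) : ℂ) with hs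
  have hsj : ∀ j, s j = ((p⁻¹ * ‖y j‖ + q⁻¹ * ‖v j‖ : ℝ) : ℂ) := fun j => by
    rw [hs, Pi.add_apply, Complex.ofReal_add]
  have hsn : ∀ j, ‖s j‖ = p⁻¹ * ‖y j‖ + q⁻¹ * ‖v j‖ := fun j => by
    rw [hsj, Complex.norm_real, Real.norm_of_nonneg (by positivity)]
  have hs0 : ∀ j, n ≤ j → s j = 0 := fun j hj => by rw [hsj, hy j hj, hv j hj]; simp
  have hsl2 : l2Norm n s ≤ 2 := by
    have h1 : l2Norm n (fun j => ((p⁻¹ * ‖y j‖ : ℝ) : ℂ)) ≤ p⁻¹ * p :=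
      l2Norm_le_mul (inv_nonneg.2 hp.le) fun j _ => by
        rw [Complex.norm_real, Real.norm_of_nonneg (by positivity)]
    have h2 : l2Norm n (fun j => ((q⁻¹ * ‖v j‖ : ℝ) : ℂ)) ≤ q⁻¹ * q :=
      l2Norm_le_mul (inv_nonneg.2 hq.le) fun j _ => by
        rw [Complex.norm_real, Real.norm_of_nonneg (by positivity)]
    rw [inv_mul_cancel₀ hp.ne'] at h1
    rw [inv_mul_cancel₀ hq.ne'] at h2
    exact (l2Norm_add_le n _ _).trans (by linarith)
  have hsi : interpENorm b s ≤ ENNReal.ofReal (unconditionalConst b * 2) :=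
    (interpENorm_le_l2Norm b hs0).trans
      (ENNReal.ofReal_le_ofReal (mul_le_mul_of_nonneg_left hsl2 hK))
  have key : ∀ (w : ℕ → ℂ) (k : ℝ), 0 ≤ k → (∀ j, ‖w j‖ ≤ k * ‖s j‖) →
      ∃ a : ℕ → ℂ, w = a * s ∧
        l2Norm n (Ω w - a * Ω s) ≤ 2 * unconditionalConst b ^ 3 * D * k := by
    intro w k hk hw
    -- Where `s j = 0` the quotient takes the default value `0`, which is harmless since `w j = 0`
    -- there.
    obtain ⟨A, hA, hAn⟩ := exists_lp_eq (a := fun j => w j / s j) hk fun j => by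
      rw [norm_div]
      exact div_le_of_le_mul₀ (norm_nonneg _) hk (hw j)
    have hwA : w = ⇑A * s := by
      ext j
      rw [hA, Pi.mul_apply]
      rcases eq_or_ne (s j) 0 with h | h
      · have := hw j
        rw [h, norm_zero, mul_zero] at this
        rw [h, mul_zero]
        exact norm_le_zero_iff.1 this
      · rw [div_mul_cancel₀ _ h]
    refine ⟨⇑A, hwA, ?_⟩
    have h1 := hΩ.le A (by positivity) hsi
    rw [← hwA] at h1
    refine (l2Norm_le_of_interpENorm_le (n := n) (by positivity) h1).trans ?_
    calc unconditionalConst b ^ 2 * (D * ‖A‖ * (unconditionalConst b * 2))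
        ≤ unconditionalConst b ^ 2 * (D * k * (unconditionalConst b * 2)) := by gcongr
      _ = _ := by ring
  obtain ⟨a, hya, ha⟩ := key y p hp.le fun j => by
    rw [hsn, mul_add, ← mul_assoc, mul_inv_cancel₀ hp.ne', one_mul]
    exact le_add_of_nonneg_right (by positivity)
  obtain ⟨c, hvc, hc⟩ := key v q hq.le fun j => by
    rw [hsn, mul_add, ← mul_assoc q q⁻¹, mul_inv_cancel₀ hq.ne', one_mul]
    exact le_add_of_nonneg_left (by positivity)
  -- With `y = a s` and `v = c s`, both `a Ω(s) v` and `y c Ω(s)` equal `a c s Ω(s)`, so they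
  -- cancel.
  have hsum : ∑ j ∈ Finset.range n, (Ω y j * v j - y j * Ω v j) =
      ∑ j ∈ Finset.range n, (Ω y - a * Ω s) j * v j -
        ∑ j ∈ Finset.range n, y j * (Ω v - c * Ω s) j := by
    rw [← Finset.sum_sub_distrib]
    refine Finset.sum_congr rfl fun j _ => ?_
    have h1 : y j = a j * s j := congrFun hya j
    have h2 : v j = c j * s j := congrFun hvc j
    simp only [Pi.sub_apply, Pi.mul_apply]
    linear_combination (a j * Ω s j) * h2 - (c j * Ω s j) * h1
  rw [hsum]
  refine (norm_sub_le _ _).trans ((add_le_add (norm_sum_mul_le_l2Norm _ _ _)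
    (norm_sum_mul_le_l2Norm _ _ _)).trans ?_)
  calc l2Norm n (Ω y - a * Ω s) * q + p * l2Norm n (Ω v - c * Ω s)
      ≤ 2 * unconditionalConst b ^ 3 * D * p * q + p * (2 * unconditionalConst b ^ 3 * D * q) := by
        gcongr
    _ = _ := by ring

/-- `Ω y` may leave the first `n` coordinates. Their indicator is a multiplier of norm at most 1
that fixes `y`, so the centralizer inequality bounds the tail. -/
theorem IsCentralizer.interpENorm_sub_truncate_le (hΩ : IsCentralizer b D Ω) {y : ℕ → ℂ}
    (hy : ∀ j, n ≤ j → y j = 0) : interpENorm b (Ω y - truncate n (Ω y)) ≤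
      ENNReal.ofReal (D * unconditionalConst b * l2Norm n y) := by
  have hK := unconditionalConst_nonneg b
  have hD := hΩ.nonneg
  have hl := l2Norm_nonneg n y
  obtain ⟨P, hP, hPn⟩ := exists_lp_eq (a := truncate n 1) zero_le_one fun j => by
    rw [truncate]
    split_ifs <;> simp
  have hmul : ∀ x, ⇑P * x = truncate n x := fun x => by
    ext j
    rw [hP, Pi.mul_apply, truncate, truncate]
    split_ifs <;> simp
  have hyy : truncate n y = y := by
    ext j
    rcases lt_or_ge j n with hj | hj
    · exact truncate_of_lt hj y
    · rw [truncate_of_le hj, hy j hj]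
  have h := hΩ.le P (by positivity) (interpENorm_le_l2Norm b hy)
  rw [hmul, hmul, hyy] at h
  refine h.trans (ENNReal.ofReal_le_ofReal ?_)
  calc D * ‖P‖ * (unconditionalConst b * l2Norm n y)
      ≤ D * 1 * (unconditionalConst b * l2Norm n y) := by gcongr
    _ = _ := by ring

/-- `x - Ωy` splits into a finitely supported part and the tail of `Ωy`. -/
theorem IsCentralizer.twistedENorm_lt_top (hΩ : IsCentralizer b D Ω) (p : pairSection n) :
    twistedENorm b Ω p < ∞ := by
  have hx : ∀ j, n ≤ j → p.1.1 j = 0 := fun j hj => (p.2 j hj).1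
  have hy : ∀ j, n ≤ j → p.1.2 j = 0 := fun j hj => (p.2 j hj).2
  have hK := unconditionalConst_nonneg b
  have hD := hΩ.nonneg
  have h1 := interpENorm_neg_le (mul_nonneg (mul_nonneg hD hK) (l2Norm_nonneg n _))
    (hΩ.interpENorm_sub_truncate_le hy)
  have h2 := interpENorm_le_l2Norm b (n := n) (x := p.1.1 - truncate n (Ω p.1.2)) fun j hj => by
    rw [Pi.sub_apply, hx j hj, truncate_of_le hj, sub_zero]
  have h3 := interpENorm_add_le (mul_nonneg hK (l2Norm_nonneg n _))
    (mul_nonneg (mul_nonneg hD hK) (l2Norm_nonneg n _)) h2 h1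
  have h4 : p.1.1 - truncate n (Ω p.1.2) + -(Ω p.1.2 - truncate n (Ω p.1.2)) =
      p.1.1 - Ω p.1.2 := by abel
  rw [h4] at h3
  exact ENNReal.add_lt_top.2 ⟨h3.trans_lt ENNReal.ofReal_lt_top,
    (interpENorm_le_l2Norm b hy).trans_lt ENNReal.ofReal_lt_top⟩

theorem dualityMap_apply (p q : pairSection n) : dualityMap n p q =
    ∑ j ∈ Finset.range n, (p.1.1 j * q.1.2 j + p.1.2 j * q.1.1 j) := rfl

/-- Boundedness of the duality map from `d_Ω` to the dual of `d_{-Ω}`. -/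
theorem IsCentralizer.twistedDualENorm_le (hΩ : IsCentralizer b D Ω) {g : ℝ}
    (hg : unconditionalConst b ^ 4 + 4 * unconditionalConst b ^ 7 * D ≤ g) (p : pairSection n) :
    twistedDualENorm b (-Ω) n (dualityMap n p) ≤ ENNReal.ofReal g * twistedENorm b Ω p := by
  have hK := unconditionalConst_nonneg b
  have hD := hΩ.nonneg
  have hg0 : 0 ≤ g := le_trans (by positivity) hg
  refine iSup₂_le fun q hq => ?_
  rw [twistedENorm_neg] at hq
  have hpfin := ENNReal.add_lt_top.1 (hΩ.twistedENorm_lt_top p)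
  have hqfin := ENNReal.add_lt_top.1 (hq.trans_lt ENNReal.one_lt_top)
  obtain ⟨α, hα, hα'⟩ := exists_ofReal_eq hpfin.1
  obtain ⟨β, hβ, hβ'⟩ := exists_ofReal_eq hpfin.2
  obtain ⟨γ, hγ, hγ'⟩ := exists_ofReal_eq hqfin.1
  obtain ⟨δ, hδ, hδ'⟩ := exists_ofReal_eq hqfin.2
  rw [twistedENorm, hα', hβ', ← ENNReal.ofReal_add hα hβ, ← ENNReal.ofReal_mul hg0]
  rw [hγ', hδ', ← ENNReal.ofReal_add hγ hδ, ENNReal.ofReal_le_one] at hq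
  refine ENNReal.ofReal_le_ofReal ?_
  have h1 := l2Norm_le_of_interpENorm_le (n := n) hα hα'.le
  have h2 := l2Norm_le_of_interpENorm_le (n := n) hβ hβ'.le
  have h3 := l2Norm_le_of_interpENorm_le (n := n) hγ hγ'.le
  have h4 := l2Norm_le_of_interpENorm_le (n := n) hδ hδ'.le
  have hcomm := hΩ.norm_commutator_le (n := n) (y := p.1.2) (v := q.1.2)
    (fun j hj => (p.2 j hj).2) (fun j hj => (q.2 j hj).2)
  -- Inserting `Ω` shows the two quantities that the quasi-norms measure, at the price of one
  -- commutator.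
  have hsum : dualityMap n p q = ∑ j ∈ Finset.range n, (p.1.1 - Ω p.1.2) j * q.1.2 j +
      ∑ j ∈ Finset.range n, p.1.2 j * (q.1.1 + Ω q.1.2) j +
      ∑ j ∈ Finset.range n, (Ω p.1.2 j * q.1.2 j - p.1.2 j * Ω q.1.2 j) := by
    rw [dualityMap_apply, ← Finset.sum_add_distrib, ← Finset.sum_add_distrib]
    refine Finset.sum_congr rfl fun j _ => ?_
    simp only [Pi.sub_apply, Pi.add_apply]
    ring
  rw [hsum]
  refine (norm_add₃_le).trans ((add_le_add (add_le_add (norm_sum_mul_le_l2Norm _ _ _)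
    (norm_sum_mul_le_l2Norm _ _ _)) hcomm).trans ?_)
  set K := unconditionalConst b
  have hδ1 : δ ≤ 1 := by linarith
  have hγ1 : γ ≤ 1 := by linarith
  have e1 : l2Norm n (p.1.1 - Ω p.1.2) * l2Norm n q.1.2 ≤ (K ^ 2 * α) * (K ^ 2 * 1) :=
    mul_le_mul h1 (h4.trans (by gcongr)) (l2Norm_nonneg _ _) (by positivity)
  have e2 : l2Norm n p.1.2 * l2Norm n (q.1.1 + Ω q.1.2) ≤ (K ^ 2 * β) * (K ^ 2 * 1) :=
    mul_le_mul h2 (h3.trans (by gcongr)) (l2Norm_nonneg _ _) (by positivity)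
  have e3 : 4 * K ^ 3 * D * l2Norm n p.1.2 * l2Norm n q.1.2 ≤
      4 * K ^ 3 * D * (K ^ 2 * β) * (K ^ 2 * 1) :=
    mul_le_mul (mul_le_mul_of_nonneg_left h2 (by positivity)) (h4.trans (by gcongr))
      (l2Norm_nonneg _ _) (by positivity)
  calc _ ≤ (K ^ 2 * α) * (K ^ 2 * 1) + (K ^ 2 * β) * (K ^ 2 * 1) +
        4 * K ^ 3 * D * (K ^ 2 * β) * (K ^ 2 * 1) := add_le_add (add_le_add e1 e2) e3
    _ ≤ (K ^ 4 + 4 * K ^ 7 * D) * (α + β) := by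
        have : 0 ≤ 4 * K ^ 7 * D * α := by positivity
        nlinarith
    _ ≤ g * (α + β) := by gcongr

/-- The lower estimate for the duality map from `d_Ω` to the dual of `d_{-Ω}`. -/
theorem IsCentralizer.twistedENorm_le (hΩ : IsCentralizer b D Ω) {g : ℝ} (hg0 : 0 < g)
    (hg : unconditionalConst b ^ 2 * (2 * D + 2 + 4 * unconditionalConst b ^ 3 * D) ≤ g)
    (p : pairSection n) :
    twistedENorm b Ω p ≤ ENNReal.ofReal g * twistedDualENorm b (-Ω) n (dualityMap n p) := by
  have hK := unconditionalConst_nonneg b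
  have hD := hΩ.nonneg
  -- Positivity of `g` matters here: `0 * ∞` would be `0`.
  rcases eq_or_ne (twistedDualENorm b (-Ω) n (dualityMap n p)) ∞ with htop | htop
  · rw [htop, ENNReal.mul_top (ENNReal.ofReal_pos.2 hg0).ne']
    exact le_top
  obtain ⟨N, hN, hN'⟩ := exists_ofReal_eq htop.lt_top
  have htest := fun {q : pairSection n} {r s : ℝ} => hΩ.norm_apply_le hN hN'.le (q := q) (r := r)
    (s := s)
  set K := unconditionalConst b with hKdef
  have hx : ∀ j, n ≤ j → p.1.1 j = 0 := fun j hj => (p.2 j hj).1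
  have hy : ∀ j, n ≤ j → p.1.2 j = 0 := fun j hj => (p.2 j hj).2
  -- On `(u, 0)` the twisted quasi-norm is just the norm of `u`, since `Ω 0 = 0`.
  have hl2y : l2Norm n p.1.2 ≤ N * K := by
    refine l2Norm_le_of_forall (by positivity) fun u hu => ?_
    have h1 := htest (q := ⟨(u, 0), fun j hj => ⟨hu j hj, rfl⟩⟩) (r := K * l2Norm n u) (s := 0)
      (mul_nonneg hK (l2Norm_nonneg n u)) le_rfl
      (by
        change interpENorm b (u + Ω 0) ≤ _
        rw [hΩ.map_zero, add_zero]
        exact interpENorm_le_l2Norm b hu)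
      (by
        change interpENorm b 0 ≤ _
        rw [interpENorm_zero]
        exact zero_le)
    rw [dualityMap_apply] at h1
    simp only [Pi.zero_apply, mul_zero, zero_add, add_zero] at h1
    rwa [← mul_assoc] at h1
  have hyi : interpENorm b p.1.2 ≤ ENNReal.ofReal (K ^ 2 * N) := by
    refine (interpENorm_le_l2Norm b hy).trans (ENNReal.ofReal_le_ofReal ?_)
    exact (mul_le_mul_of_nonneg_left hl2y hK).trans (le_of_eq (by ring))
  have htail : interpENorm b (-(Ω p.1.2 - truncate n (Ω p.1.2))) ≤
      ENNReal.ofReal (D * K ^ 2 * N) := by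
    refine interpENorm_neg_le (by positivity) ((hΩ.interpENorm_sub_truncate_le hy).trans
      (ENNReal.ofReal_le_ofReal ?_))
    exact (mul_le_mul_of_nonneg_left hl2y (mul_nonneg hD hK)).trans (le_of_eq (by ring))
  -- `Ω y` is truncated so that `w` is finitely supported and Euclidean estimates apply; the tail is
  -- `htail`.
  set w := p.1.1 - truncate n (Ω p.1.2) with hw
  have hw0 : ∀ j, n ≤ j → w j = 0 := fun j hj => by
    rw [hw, Pi.sub_apply, hx j hj, truncate_of_le hj, sub_zero]
  -- The test vectors are `(-Ωv, v)` with the first entry truncated. Their twisted component is only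
  -- the tail of `Ωv`, and the functional equals `⟨w, v⟩` plus a commutator.
  have hl2w : l2Norm n w ≤ N * (D * K + K + 4 * K ^ 4 * D) := by
    refine l2Norm_le_of_forall (by positivity) fun v hv => ?_
    have hlv := l2Norm_nonneg n v
    have hmem : (-truncate n (Ω v), v) ∈ pairSection n := fun j hj =>
      ⟨neg_eq_zero.2 (truncate_of_le hj _), hv j hj⟩
    have h1 := htest (q := ⟨_, hmem⟩)
      (r := D * K * l2Norm n v) (s := K * l2Norm n v) (by positivity) (by positivity)
      (by
        change interpENorm b (-truncate n (Ω v) + Ω v) ≤ _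
        rw [neg_add_eq_sub]
        exact hΩ.interpENorm_sub_truncate_le hv)
      (interpENorm_le_l2Norm b hv)
    have h2 := hΩ.norm_commutator_le hy hv
    have hsum : ∑ j ∈ Finset.range n, w j * v j =
        dualityMap n p ⟨_, hmem⟩ -
        ∑ j ∈ Finset.range n, (Ω p.1.2 j * v j - p.1.2 j * Ω v j) := by
      rw [dualityMap_apply, ← Finset.sum_sub_distrib]
      refine Finset.sum_congr rfl fun j hj => ?_
      have hj' := Finset.mem_range.1 hj
      simp only [hw, Pi.sub_apply, Pi.neg_apply, truncate_of_lt hj']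
      ring
    rw [hsum]
    refine (norm_sub_le _ _).trans ((add_le_add h1 h2).trans ?_)
    have h3 : 4 * K ^ 3 * D * l2Norm n p.1.2 * l2Norm n v ≤
        4 * K ^ 3 * D * (N * K) * l2Norm n v := by gcongr
    calc N * (D * K * l2Norm n v + K * l2Norm n v) + 4 * K ^ 3 * D * l2Norm n p.1.2 * l2Norm n v
        ≤ N * (D * K * l2Norm n v + K * l2Norm n v) + 4 * K ^ 3 * D * (N * K) * l2Norm n v :=
          add_le_add le_rfl h3
      _ = _ := by ring
  have hwi : interpENorm b w ≤ ENNReal.ofReal (K * (N * (D * K + K + 4 * K ^ 4 * D))) :=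
    (interpENorm_le_l2Norm b hw0).trans
      (ENNReal.ofReal_le_ofReal (mul_le_mul_of_nonneg_left hl2w hK))
  have hxi := interpENorm_add_le (by positivity) (by positivity) hwi htail
  have hsplit : w + -(Ω p.1.2 - truncate n (Ω p.1.2)) = p.1.1 - Ω p.1.2 := by
    rw [hw]
    abel
  rw [hsplit] at hxi
  rw [hN', ← ENNReal.ofReal_mul hg0.le, twistedENorm]
  refine (add_le_add hxi hyi).trans ?_
  rw [← ENNReal.ofReal_add (by positivity) (by positivity)]
  refine ENNReal.ofReal_le_ofReal (le_trans (le_of_eq ?_) (mul_le_mul_of_nonneg_right hg hN))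
  ring

end Centralizer

/-! ### Bijectivity of the duality map on finite sections. -/

section Algebraic

variable {n : ℕ}

theorem dualityMap_injective : Function.Injective (dualityMap n) := by
  intro p p' h
  have hq : ∀ q, dualityMap n p q = dualityMap n p' q := fun q => by rw [h]
  refine Subtype.ext (Prod.ext (funext fun j => ?_) (funext fun j => ?_))
  · rcases lt_or_ge j n with hj | hj
    · have := hq ⟨(0, unitSeq j), fun i hi => ⟨rfl, Pi.single_eq_of_ne (by omega) _⟩⟩
      simpa [dualityMap_apply, unitSeq, Pi.single_apply, hj] using this
    · rw [(p.2 j hj).1, (p'.2 j hj).1]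
  · rcases lt_or_ge j n with hj | hj
    · have := hq ⟨(unitSeq j, 0), fun i hi => ⟨Pi.single_eq_of_ne (by omega) _, rfl⟩⟩
      simpa [dualityMap_apply, unitSeq, Pi.single_apply, hj] using this
    · rw [(p.2 j hj).2, (p'.2 j hj).2]

theorem dualityMap_surjective : Function.Surjective (dualityMap n) := by
  intro φ
  -- Truncation makes these vectors available for every `j`; for `j < n` it changes nothing.
  set e : ℕ → pairSection n := fun j =>
    ⟨(truncate n (unitSeq j), 0), fun i hi => ⟨truncate_of_le hi _, rfl⟩⟩ with he
  set f : ℕ → pairSection n := fun j =>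
    ⟨(0, truncate n (unitSeq j)), fun i hi => ⟨rfl, truncate_of_le hi _⟩⟩ with hf
  have hexp : ∀ x : ℕ → ℂ, (∀ j, n ≤ j → x j = 0) →
      ∑ j ∈ Finset.range n, x j • truncate n (unitSeq j) = x := by
    intro x hx
    refine Eq.trans (Finset.sum_congr rfl fun j hj => ?_) (eq_sum_unitSeq hx).symm
    congr 1
    ext i
    rcases lt_or_ge i n with hi | hi
    · exact truncate_of_lt hi _
    · rw [truncate_of_le hi, unitSeq, Pi.single_eq_of_ne]
      have := Finset.mem_range.1 hj
      omega
  refine ⟨⟨(truncate n fun j => φ (f j), truncate n fun j => φ (e j)), fun j hj =>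
    ⟨truncate_of_le hj fun j => φ (f j), truncate_of_le hj fun j => φ (e j)⟩⟩, ?_⟩
  ext q
  have hq : q = ∑ j ∈ Finset.range n, (q.1.2 j • f j + q.1.1 j • e j) := by
    refine Subtype.ext ?_
    rw [AddSubmonoidClass.coe_finsetSum]
    refine Prod.ext ?_ ?_
    · rw [Prod.fst_sum]
      refine (hexp _ fun j hj => (q.2 j hj).1).symm.trans (Finset.sum_congr rfl fun j _ => ?_)
      simp [he, hf]
    · rw [Prod.snd_sum]
      refine (hexp _ fun j hj => (q.2 j hj).2).symm.trans (Finset.sum_congr rfl fun j _ => ?_)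
      simp [he, hf]
  rw [dualityMap_apply]
  conv_rhs => rw [hq]
  simp only [map_sum, map_add, map_smul, smul_eq_mul]
  refine Finset.sum_congr rfl fun j hj => ?_
  have hj' := Finset.mem_range.1 hj
  simp only [truncate_of_lt hj']
  ring

end Algebraic

end DerivedTwisted

/-! ### Choice of the constants and assembly of (a) and (b). -/

theorem mainTheorem5 :
    ∃ (lam : ℝ → ℝ) (g : ℝ → ℝ → ℝ), (∀ K, 0 < lam K) ∧ (∀ K D, 0 < g K D) ∧
      ∀ (X : Type u) [NormedAddCommGroup X] [NormedSpace ℂ X] [CompleteSpace X]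
        (b : UnconditionalSchauderBasis ℕ ℂ X),
        -- `Z(Xₙ)` is `λ`-isomorphic to its dual, through the natural duality
        (∀ n : ℕ, 1 ≤ n →
          ∃ T : ZFin b n ≃L[ℂ] StrongDual ℂ (ZFin b n),
            (∀ p q : ZFin b n,
              T p q = ∑ j ∈ Finset.range n, (p.snd j * q.fst j - p.fst j * q.snd j)) ∧
            ‖(T : ZFin b n →L[ℂ] StrongDual ℂ (ZFin b n))‖ *
              ‖(T.symm : StrongDual ℂ (ZFin b n) →L[ℂ] ZFin b n)‖ ≤
                lam (unconditionalConst b)) ∧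
        -- for the centralizers `Ω` of the couple, `I` is an isomorphism of `d_{Ωⁿ}` onto the dual
        -- of `d_{-Ωⁿ}` with constants controlled by the centralizer constant
        (∀ (ρ : ℝ) (B : (ℕ → ℂ) → calderon b), 1 < ρ → IsBoundedSelection b ρ B →
          ∀ Ω : (ℕ → ℂ) → (ℕ → ℂ), Ω = selectionMap B →
            centralizerConst b Ω ≤ ENNReal.ofReal (4 * unconditionalConst b * ρ) ∧
            ∀ n : ℕ, 1 ≤ n →
              Set.BijOn (dualityMap n) Set.univ
                {φ | twistedDualENorm b (-Ω) n φ < ⊤} ∧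
              ∀ p : pairSection n,
                twistedDualENorm b (-Ω) n (dualityMap n p) ≤
                  ENNReal.ofReal (g (unconditionalConst b) (centralizerConst b Ω).toReal) *
                    twistedENorm b Ω p ∧
                twistedENorm b Ω p ≤
                  ENNReal.ofReal (g (unconditionalConst b) (centralizerConst b Ω).toReal) *
                    twistedDualENorm b (-Ω) n (dualityMap n p)) := by
  -- Absolute values and the final `+ 1` give positivity at all real arguments. `g` adds the
  -- constants of the upper and lower estimates, both taken at `D + 1` because of the slack in
  -- `IsBoundedSelection.isCentralizer`.
  refine ⟨fun K => 4 * |K| * (6 * |K| ^ 2 + 36 * |K| ^ 5) + 1,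
    fun K D => (|K| ^ 4 + 4 * |K| ^ 7 * (|D| + 1)) +
      |K| ^ 2 * (2 * (|D| + 1) + 2 + 4 * |K| ^ 3 * (|D| + 1)) + 1,
    fun K => by positivity, fun K D => by positivity, fun X _ _ _ b => ⟨fun n _ => ?_, ?_⟩⟩
  · obtain ⟨T, hT, hTn⟩ := exists_derivedDuality_equiv b n
    refine ⟨T, hT, hTn.trans ?_⟩
    dsimp only
    rw [abs_of_nonneg (unconditionalConst_nonneg b)]
    exact le_add_of_nonneg_right zero_le_one
  · rintro ρ B hρ hB Ω rfl
    have hρ0 : 0 ≤ ρ := zero_le_one.trans hρ.le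
    have hΩ := hB.isCentralizer hρ0
    have hK := unconditionalConst_nonneg b
    have hΔ : 0 ≤ (centralizerConst b (selectionMap B)).toReal := ENNReal.toReal_nonneg
    refine ⟨hB.centralizerConst_le hρ0, fun n _ => ?_⟩
    dsimp only
    rw [abs_of_nonneg hK, abs_of_nonneg hΔ]
    set K := unconditionalConst b with hKdef
    set Δ := (centralizerConst b (selectionMap B)).toReal with hΔdef
    have hupper := fun p : pairSection n => hΩ.twistedDualENorm_le
      (g := (K ^ 4 + 4 * K ^ 7 * (Δ + 1)) +
        K ^ 2 * (2 * (Δ + 1) + 2 + 4 * K ^ 3 * (Δ + 1)) + 1) (by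
          rw [add_assoc]
          exact le_add_of_nonneg_right (by positivity)) p
    -- The duality map is already onto the whole algebraic dual, so finiteness of the dual norm is
    -- needed only to see that its values lie in the target set.
    refine ⟨⟨fun p _ => ?_, dualityMap_injective.injOn, fun φ _ => ?_⟩, fun p => ⟨hupper p, ?_⟩⟩
    · exact (hupper p).trans_lt
        (ENNReal.mul_lt_top ENNReal.ofReal_lt_top (hΩ.twistedENorm_lt_top p))
    · obtain ⟨p, hp⟩ := dualityMap_surjective φ
      exact ⟨p, trivial, hp⟩
    · refine hΩ.twistedENorm_le (add_pos_of_nonneg_of_pos (by positivity) one_pos) ?_ p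
      have : 0 ≤ K ^ 4 + 4 * K ^ 7 * (Δ + 1) := by positivity
      linarith
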